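/- **Setting.** A network has agents $1,\dots,N$ joined by an undirected graph. Agent $k$ has a cost $J_k:\mathbb{R}^M\to\mathbb{R}$ with minimizer $w_k^o$; two agents belong to the same cluster iff their minimizers coincide. The agents are partitioned into groups $\mathcal G_1,\dots,\mathcal G_G$; each group is a nonempty connected set of agents of one cluster. $\|\cdot\|$ is the Euclidean norm of vectors and the induced 2-norm of matrices, $\mathrm{col}\{\cdot\}$ stacks vectors, $\mathcal W=\mathrm{col}\{w_1,\dots,w_N\}\in\mathbb{R}^{NM}$, and $\mathcal W^o=\mathrm{col}\{w_1^o,\dots,w_N^o\}$. *Costs.* Each $J_k$ is strictly convex and twice differentiable with $\lambda_{k,L}I\le\nabla^2J_k(w)\le\lambda_{k,U}I$ for all $w$, where $0\le\lambda_{k,L}\le\lambda_{k,U}<\infty$; every group contains an agent $k$ with $\lambda_{k,L}>0$; and $\nabla^2J(\mathcal W)=\mathrm{diag}\{\nabla^2J_k(w_k)\}_{k=1}^N$ satisfies $\|\nabla^2J(\mathcal W_1)-\nabla^2J(\mathcal W_2)\|\le\kappa_H\|\mathcal W_1-\mathcal W_2\|$ for all $\mathcal W_1,\mathcal W_2$.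 *Combination weights.* $A=[a_{\ell k}]$ with $a_{\ell k}>0$ if $\ell$ and $k$ lie in the same group and $\ell$ is $k$ or a neighbour of $k$, $a_{\ell k}=0$ otherwise, and $\sum_\ell a_{\ell k}=1$ for all $k$. Put $\mathcal A=A\otimes I_M$. *Recursions.* Given step-sizes $\mu_k>0$, let $\mu_{\max}=\max_k\mu_k$ and $\mathcal M=\mathrm{diag}\{\mu_1,\dots,\mu_N\}\otimes I_M$. Let $\hat g_{k,i}(w)$ be the random approximation of $\nabla J_k(w)$ used by agent $k$ at iteration $i\ge1$. Starting from a random $\mathcal W_0$, the adapt-then-combine iterates $\mathcal W_i=\mathrm{col}\{w_{1,i},\dots,w_{N,i}\}$ are $$w_{k,i}=\sum_{\ell}a_{\ell k}\bigl(w_{\ell,i-1}-\mu_\ell\,\hat g_{\ell,i}(w_{\ell,i-1})\bigr).$$ The gradient noise is $\mathcal S_i(\mathcal W)=\mathrm{col}\{\hat g_{k,i}(w_k)-\nabla J_k(w_k)\}_{k=1}^N$. The network error is $\widetilde{\mathcal W}_i=\mathcal W^o-\mathcal W_i$; equivalently, it evolves by the nonlinear error recursion $$\widetilde{\mathcal W}_i=\mathcal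 A^{\mathsf T}(I-\mathcal M\mathcal H_{i-1})\widetilde{\mathcal W}_{i-1}+\mathcal A^{\mathsf T}\mathcal M\,\mathcal S_i(\mathcal W_{i-1}),\qquad \mathcal H_{i-1}=\int_0^1\nabla^2J(\mathcal W^o-t\widetilde{\mathcal W}_{i-1})\,dt.$$ The long-term model, started at a random $\widetilde{\mathcal W}_0^{\rm long}$, is $$\widetilde{\mathcal W}_i^{\rm long}=\mathcal A^{\mathsf T}(I-\mathcal M\mathcal H)\widetilde{\mathcal W}_{i-1}^{\rm long}+\mathcal A^{\mathsf T}\mathcal M\,\mathcal S_i(\mathcal W_{i-1}),\qquad\mathcal H=\nabla^2J(\mathcal W^o).$$ *Gradient noise.* On a probability space with a filtration $(\mathbb F_i)_{i\ge0}$, for every $i\ge1$ and every $\mathbb F_{i-1}$-measurable random $\mathcal W$, $\mathcal S_i(\mathcal W)$ is $\mathbb F_i$-measurable; and if moreover $\mathbb E\|\mathcal W\|^4<\infty$, then $\mathbb E\|\mathcal S_i(\mathcal W)\|^4<\infty$ and, almost surely, $$\mathbb E[\mathcal S_i(\mathcal W)\mid\mathbb F_{i-1}]=0,\qquad \mathbb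 E[\|\mathcal S_i(\mathcal W)\|^4\mid\mathbb F_{i-1}]\le\alpha^2\|\mathcal W^o-\mathcal W\|^4+\sigma_s^4$$ with constants $\alpha,\sigma_s\ge0$. **Lemma (Accuracy of long-term model).** Fix the graph, the groups, the costs, $A$, $\alpha$, $\sigma_s$ and a number $\tau>0$. There are $\mu_0>0$ and $C\ge0$ such that for all step-sizes with $\mu_k>0$ and $\mu_k\ge\tau\mu_{\max}$ for every $k$ and $\mu_{\max}\le\mu_0$, for every gradient noise process as above, every $\mathbb F_0$-measurable $\mathcal W_0$ with $\mathbb E\|\mathcal W_0\|^4<\infty$, and every $\widetilde{\mathcal W}_0^{\rm long}$ with $\mathbb E\|\widetilde{\mathcal W}_0^{\rm long}\|^2<\infty$, $$\limsup_{i\to\infty}\ \mathbb E\bigl\|\widetilde{\mathcal W}_i-\widetilde{\mathcal W}_i^{\rm long}\bigr\|^2\le C\,\mu_{\max}^2 .$$ -/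

import Mathlib

open MeasureTheory ProbabilityTheory Filter Topology
open scoped ENNReal NNReal

namespace MultitaskDiffusion

noncomputable section

/-- The parameter space `ℝ^M` of a single agent, with the Euclidean norm. -/
abbrev AgentSpace (M : ℕ) := EuclideanSpace ℝ (Fin M)

/-- The network space `ℝ^{NM}`: stacked vectors `col{w_1, …, w_N}` with the Euclidean norm
`‖w‖² = ∑ k, ‖w_k‖²`. -/
abbrev NetSpace (N M : ℕ) := PiLp 2 (fun _ : Fin N => AgentSpace M)

variable {N M G : ℕ}

/-- The Hessian `∇²f(w)`, as the derivative of the gradient field. -/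
def hessian (f : AgentSpace M → ℝ) (w : AgentSpace M) : AgentSpace M →L[ℝ] AgentSpace M :=
  fderiv ℝ (gradient f) w

/-- The continuous linear map `v ↦ col{T_1 v, …, T_N v}` into the network space. -/
def stackOp (T : Fin N → NetSpace N M →L[ℝ] AgentSpace M) : NetSpace N M →L[ℝ] NetSpace N M :=
  ((PiLp.continuousLinearEquiv 2 ℝ (fun _ : Fin N => AgentSpace M)).symm :
    (Fin N → AgentSpace M) →L[ℝ] NetSpace N M) ∘L ContinuousLinearMap.pi T

/-- The block diagonal operator `diag{T_1, …, T_N}` on the network space. -/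
def blockDiag (T : Fin N → AgentSpace M →L[ℝ] AgentSpace M) : NetSpace N M →L[ℝ] NetSpace N M :=
  stackOp fun k => T k ∘L PiLp.proj 2 (fun _ : Fin N => AgentSpace M) k

/-- The operator `(A ⊗ I_M)ᵀ` on the network space: `v ↦ col{∑ ℓ, a_{ℓk} v_ℓ}`. -/
def combineOp (A : Matrix (Fin N) (Fin N) ℝ) : NetSpace N M →L[ℝ] NetSpace N M :=
  stackOp fun k => ∑ l, A l k • PiLp.proj 2 (fun _ : Fin N => AgentSpace M) l

theorem stackOp_apply (T : Fin N → NetSpace N M →L[ℝ] AgentSpace M) (v : NetSpace N M)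
    (k : Fin N) : stackOp T v k = T k v := rfl

theorem blockDiag_apply (T : Fin N → AgentSpace M →L[ℝ] AgentSpace M) (v : NetSpace N M)
    (k : Fin N) : blockDiag T v k = T k (v k) := rfl

theorem combineOp_apply (A : Matrix (Fin N) (Fin N) ℝ) (v : NetSpace N M) (k : Fin N) :
    combineOp A v k = ∑ l, A l k • v l := by
  simp [combineOp, stackOp_apply]

/-- The operator `diag{μ_1, …, μ_N} ⊗ I_M` on the network space. -/
def stepOp (μ : Fin N → ℝ) : NetSpace N M →L[ℝ] NetSpace N M :=
  blockDiag fun k => μ k • ContinuousLinearMap.id ℝ (AgentSpace M)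

/-- The network Hessian `diag{∇²J_1(w_1), …, ∇²J_N(w_N)}`. -/
def netHessian (J : Fin N → AgentSpace M → ℝ) (w : NetSpace N M) :
    NetSpace N M →L[ℝ] NetSpace N M :=
  blockDiag fun k => hessian (J k) (w k)

/-- The largest step-size `μ_max = max_k μ_k`. -/
def stepMax (μ : Fin N → ℝ) : ℝ := ⨆ k, μ k

/-- Groups of agents in a network. The map `group` assigns to each agent its group, and
`wo` collects the minimizers of the individual costs. Two agents belong to the same cluster
exactly when their individual minimizers coincide. Every group is a nonempty connected set of
agents, and all its members belong to the same cluster. -/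
structure IsGrouping (graph : SimpleGraph (Fin N)) (group : Fin N → Fin G)
    (wo : NetSpace N M) : Prop where
  connected : ∀ m, (graph.induce {k | group k = m}).Connected
  same_cluster : ∀ k l, group k = group l → wo k = wo l

/-- Combination weights `a_{ℓk}` over the groups: positive if `ℓ` is a neighbour of `k` (every
agent being a neighbour of itself) in the same group as `k`, zero otherwise, and
`∑ ℓ, a_{ℓk} = 1`. -/
structure IsCombination (graph : SimpleGraph (Fin N)) (group : Fin N → Fin G)
    (A : Matrix (Fin N) (Fin N) ℝ) : Prop where
  pos : ∀ l k, (l = k ∨ graph.Adj l k) ∧ group l = group k → 0 < A l k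
  zero : ∀ l k, ¬ ((l = k ∨ graph.Adj l k) ∧ group l = group k) → A l k = 0
  sum_eq_one : ∀ k, ∑ l, A l k = 1

/-- The conditions on the individual costs `J_k`: each is strictly convex and twice
differentiable, with minimizer `wo k` and with `lamL k • I ≤ ∇²J_k ≤ lamU k • I`; in each group
some `lamL k` is positive; the network Hessian is `κH`-Lipschitz in operator norm. -/
structure IsCostFamily (group : Fin N → Fin G) (J : Fin N → AgentSpace M → ℝ)
    (wo : NetSpace N M) (lamL lamU : Fin N → ℝ) (κH : ℝ) : Prop where
  strictConvex : ∀ k, StrictConvexOn ℝ Set.univ (J k)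
  differentiable : ∀ k, Differentiable ℝ (J k)
  differentiable_gradient : ∀ k, Differentiable ℝ (gradient (J k))
  minimizer : ∀ k, IsMinOn (J k) Set.univ (wo k)
  lamL_nonneg : ∀ k, 0 ≤ lamL k
  lamL_le_lamU : ∀ k, lamL k ≤ lamU k
  hessian_lower : ∀ k w v, lamL k * ‖v‖ ^ 2 ≤ inner ℝ (hessian (J k) w v) v
  hessian_upper : ∀ k w v, inner ℝ (hessian (J k) w v) v ≤ lamU k * ‖v‖ ^ 2
  exists_strong : ∀ m, ∃ k, group k = m ∧ 0 < lamL k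
  κH_nonneg : 0 ≤ κH
  lipschitz : ∀ w₁ w₂ : NetSpace N M,
    ‖netHessian J w₁ - netHessian J w₂‖ ≤ κH * ‖w₁ - w₂‖

section Stochastic

variable {Ω : Type*}

/-- The network gradient noise `S(w) = col{ĝ_k(w_k) - ∇J_k(w_k)}`, where `ĝ_k` is a random
approximation of `∇J_k`. -/
def netNoise (J : Fin N → AgentSpace M → ℝ) (ghat : Fin N → AgentSpace M → Ω → AgentSpace M)
    (w : NetSpace N M) (ω : Ω) : NetSpace N M :=
  WithLp.toLp 2 fun k => ghat k (w k) ω - gradient (J k) (w k)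

/-- The conditions on the gradient noise. Here `ghat (n + 1) k` is the approximate gradient that
agent `k` uses at iteration `n + 1`, and `F n` is the information available after iteration `n`.
For every `F n`-measurable network vector `W`, the noise `S_{n+1}(W)` is `F (n+1)`-measurable; if
`W` has a finite fourth moment then so has `S_{n+1}(W)`, its conditional mean given `F n` is zero
and `E[‖S_{n+1}(W)‖⁴ | F n] ≤ α² ‖wo - W‖⁴ + σ⁴`. -/
structure IsGradientNoise [mΩ : MeasurableSpace Ω] (P : Measure Ω) (F : Filtration ℕ mΩ)
    (J : Fin N → AgentSpace M → ℝ) (wo : NetSpace N M)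
    (ghat : ℕ → Fin N → AgentSpace M → Ω → AgentSpace M) (α σ : ℝ) : Prop where
  adapted : ∀ (n : ℕ) (W : Ω → NetSpace N M), StronglyMeasurable[F n] W →
    StronglyMeasurable[F (n + 1)] fun ω => netNoise J (ghat (n + 1)) (W ω) ω
  memLp : ∀ (n : ℕ) (W : Ω → NetSpace N M), StronglyMeasurable[F n] W → MemLp W 4 P →
    MemLp (fun ω => netNoise J (ghat (n + 1)) (W ω) ω) 4 P
  condExp_eq_zero : ∀ (n : ℕ) (W : Ω → NetSpace N M), StronglyMeasurable[F n] W → MemLp W 4 P →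
    P[fun ω => netNoise J (ghat (n + 1)) (W ω) ω | F n] =ᵐ[P] 0
  fourth_moment : ∀ (n : ℕ) (W : Ω → NetSpace N M), StronglyMeasurable[F n] W → MemLp W 4 P →
    ∀ᵐ ω ∂P, (P[fun ω' => ‖netNoise J (ghat (n + 1)) (W ω') ω'‖ ^ 4 | F n]) ω
      ≤ α ^ 2 * ‖wo - W ω‖ ^ 4 + σ ^ 4

/-- The adapt-then-combine diffusion iterates started at `W₀`:
`ψ_ℓ = w_ℓ - μ_ℓ ĝ_ℓ(w_ℓ)` followed by `w_k = ∑ ℓ, a_{ℓk} ψ_ℓ`. -/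
def iterate (A : Matrix (Fin N) (Fin N) ℝ) (μ : Fin N → ℝ)
    (ghat : ℕ → Fin N → AgentSpace M → Ω → AgentSpace M) (W₀ : Ω → NetSpace N M) :
    ℕ → Ω → NetSpace N M
  | 0 => W₀
  | n + 1 => fun ω => WithLp.toLp 2 fun k =>
      ∑ l, A l k • (iterate A μ ghat W₀ n ω l
        - μ l • ghat (n + 1) l (iterate A μ ghat W₀ n ω l) ω)

/-- The network error vector `W̃_n = wo - W_n` of the diffusion iterates. -/
def netError (A : Matrix (Fin N) (Fin N) ℝ) (μ : Fin N → ℝ) (wo : NetSpace N M)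
    (ghat : ℕ → Fin N → AgentSpace M → Ω → AgentSpace M) (W₀ : Ω → NetSpace N M)
    (n : ℕ) (ω : Ω) : NetSpace N M :=
  wo - iterate A μ ghat W₀ n ω

/-- The constant coefficient `B = 𝒜ᵀ (I - ℳ ℋ)`, with `ℋ = diag{∇²J_k(wo k)}`. -/
def longOp (A : Matrix (Fin N) (Fin N) ℝ) (μ : Fin N → ℝ) (J : Fin N → AgentSpace M → ℝ)
    (wo : NetSpace N M) : NetSpace N M →L[ℝ] NetSpace N M :=
  combineOp A ∘L (ContinuousLinearMap.id ℝ (NetSpace N M) - stepOp μ ∘L netHessian J wo)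

/-- The long-term model started at `L₀`: `L_{n+1} = B L_n + 𝒜ᵀ ℳ S_{n+1}(W_n)`, driven by the
gradient noise evaluated at the diffusion iterates `W_n`. -/
def longError (A : Matrix (Fin N) (Fin N) ℝ) (μ : Fin N → ℝ) (J : Fin N → AgentSpace M → ℝ)
    (wo : NetSpace N M) (ghat : ℕ → Fin N → AgentSpace M → Ω → AgentSpace M)
    (W₀ L₀ : Ω → NetSpace N M) : ℕ → Ω → NetSpace N M
  | 0 => L₀
  | n + 1 => fun ω => longOp A μ J wo (longError A μ J wo ghat W₀ L₀ n ω)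
      + combineOp A (stepOp μ (netNoise J (ghat (n + 1)) (iterate A μ ghat W₀ n ω) ω))

end Stochastic

end

end MultitaskDiffusion

/-!
The matrix `A` restricted to a connected group has a Perron vector; let `p` collect these weights,
so that `A p = p`. By Jensen's inequality combining does not increase `∑ k, p_k ‖x_k‖²`, and the
deficit is the weighted dispersion within the neighbourhoods. A gradient step decreases the same
quantity at each strongly convex agent. The sum of deficit and decrease is a quadratic form
vanishing only at `0`: zero dispersion makes `x` constant on each group, and the strongly convex
agent of the group makes that constant zero. Hence, with `t` the largest step-size, one step of the
noise-free error recursion and one step of the long-term model both contract the weighted squared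
norm by `1 - c t`.

The noise enters as a martingale increment of size `O(t)`, whose cross term with the third power of
the error has mean zero, so the fourth moment of the error satisfies
`e_{n+1} ≤ (1 - c t / 2) e_n + O(t³)` and is eventually `O(t²)`. The difference between the error
and the long-term model obeys the long-term recursion with the noise cancelled, driven by `𝒜ᵀ ℳ`
times the Taylor remainder of the gradient, of size `O(t ‖x‖²)`. Its mean square therefore satisfies
`d_{n+1} ≤ (1 - c t / 2) d_n + O(t) e_n`, and is eventually `O(t²)`.
-/

namespace MultitaskDiffusion

open scoped Matrix

variable {N M G : ℕ}

section PerronVector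

theorem eq_of_preconnected_of_adj {V β : Type*} {g : SimpleGraph V} (hg : g.Preconnected)
    {f : V → β} (hf : ∀ a b, g.Adj a b → f a = f b) (a b : V) : f a = f b := by
  obtain ⟨walk⟩ := hg a b
  induction walk with
  | nil => rfl
  | cons hadj _ ih => exact (hf _ _ hadj).trans ih

variable {ι : Type*} [Fintype ι] [DecidableEq ι] {B : Matrix ι ι ℝ}

theorem exists_ne_zero_mulVec_eq_self [Nonempty ι] (hB : B ∈ Matrix.colStochastic ℝ ι) :
    ∃ q : ι → ℝ, q ≠ 0 ∧ B *ᵥ q = q := by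
  have hdet : (B - 1).det = 0 := Matrix.exists_vecMul_eq_zero_iff.1
    ⟨1, one_ne_zero, by
      rw [Matrix.vecMul_sub, Matrix.one_vecMul_of_mem_colStochastic hB, Matrix.vecMul_one,
        sub_self]⟩
  obtain ⟨q, hq, hBq⟩ := Matrix.exists_mulVec_eq_zero_iff.2 hdet
  exact ⟨q, hq, by rwa [Matrix.sub_mulVec, Matrix.one_mulVec, sub_eq_zero] at hBq⟩

-- `|q| ≤ B |q|` entrywise, and both sides have the same sum because the columns of `B` sum to one.
theorem mulVec_abs_eq_abs (hB : B ∈ Matrix.colStochastic ℝ ι) {q : ι → ℝ} (hq : B *ᵥ q = q) :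
    B *ᵥ |q| = |q| := by
  have hle : ∀ l ∈ Finset.univ, |q l| ≤ (B *ᵥ |q|) l := fun l _ =>
    calc |q l| = |∑ k, B l k * q k| := by rw [← congrFun hq l]; rfl
      _ ≤ ∑ k, |B l k * q k| := Finset.abs_sum_le_sum_abs _ _
      _ = (B *ᵥ |q|) l := Finset.sum_congr rfl fun k _ => by
        rw [abs_mul, abs_of_nonneg (hB.1 l k), Pi.abs_apply]
  have hsum : ∑ l, |q l| = ∑ l, (B *ᵥ |q|) l :=
    (Matrix.sum_mulVec_of_mem_colStochastic hB).symm
  exact funext fun l => ((Finset.sum_eq_sum_iff_of_le hle).1 hsum l (Finset.mem_univ l)).symm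

theorem exists_pos_mulVec_eq_self_of_preconnected [Nonempty ι] (hB : B ∈ Matrix.colStochastic ℝ ι)
    {g : SimpleGraph ι} (hg : g.Preconnected) (hpos : ∀ l k, g.Adj l k → 0 < B l k) :
    ∃ p : ι → ℝ, (∀ k, 0 < p k) ∧ B *ᵥ p = p := by
  obtain ⟨q, hq, hBq⟩ := exists_ne_zero_mulVec_eq_self hB
  have hfix := mulVec_abs_eq_abs hB hBq
  have zero_of_adj : ∀ a b, g.Adj a b → q a = 0 → q b = 0 := by
    intro a b hab ha
    have hsum : ∑ k, B a k * |q k| = 0 := by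
      simpa [Matrix.mulVec, dotProduct, ha] using congrFun hfix a
    have hb := (Finset.sum_eq_zero_iff_of_nonneg fun k _ =>
      mul_nonneg (hB.1 a k) (abs_nonneg (q k))).1 hsum b (Finset.mem_univ b)
    simpa [(hpos a b hab).ne'] using hb
  have zero_const : ∀ k l, (q k = 0) = (q l = 0) := eq_of_preconnected_of_adj hg fun a b hab =>
    propext ⟨zero_of_adj a b hab, zero_of_adj b a hab.symm⟩
  refine ⟨|q|, fun k => abs_pos.2 fun hk => hq (funext fun l => ?_), hfix⟩
  exact (zero_const k l).mp hk

end PerronVector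

section Combination

variable {graph : SimpleGraph (Fin N)} {group : Fin N → Fin G} {A : Matrix (Fin N) (Fin N) ℝ}
  {wo : NetSpace N M}

theorem IsCombination.eq_zero_of_group_ne (hA : IsCombination graph group A) {l k : Fin N}
    (h : group l ≠ group k) : A l k = 0 :=
  hA.zero l k fun hlk => h hlk.2

theorem IsCombination.mem_colStochastic (hA : IsCombination graph group A) :
    A ∈ Matrix.colStochastic ℝ (Fin N) := by
  refine Matrix.mem_colStochastic_iff_sum.2 ⟨fun l k => ?_, hA.sum_eq_one⟩
  by_cases hlk : (l = k ∨ graph.Adj l k) ∧ group l = group k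
  · exact (hA.pos l k hlk).le
  · exact (hA.zero l k hlk).ge

theorem sum_fiber_eq_sum {ι κ : Type*} [Fintype ι] [DecidableEq κ] (group : ι → κ) {m : κ}
    {h : ι → ℝ} (h0 : ∀ k, group k ≠ m → h k = 0) :
    ∑ k : {k | group k = m}, h k = ∑ k, h k := by
  rw [← Finset.sum_filter_of_ne (p := fun k => group k = m) (s := Finset.univ)
    fun k _ hk => not_not.1 fun hne => hk (h0 k hne)]
  exact (Finset.sum_subtype _ (by simp) h).symm

theorem IsCombination.submatrix_mem_colStochastic (hA : IsCombination graph group A) (m : Fin G) :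
    A.submatrix Subtype.val Subtype.val ∈ Matrix.colStochastic ℝ {k | group k = m} := by
  refine Matrix.mem_colStochastic_iff_sum.2
    ⟨fun l k => hA.mem_colStochastic.1 l k, fun k => ?_⟩
  rw [← hA.sum_eq_one k]
  exact sum_fiber_eq_sum group fun l hl => hA.eq_zero_of_group_ne fun h => hl (h.trans k.2)

theorem IsCombination.exists_pos_mulVec_eq_self (hA : IsCombination graph group A)
    (hgroup : IsGrouping graph group wo) :
    ∃ p : Fin N → ℝ, (∀ k, 0 < p k) ∧ A *ᵥ p = p := by
  have perron : ∀ m : Fin G, ∃ p : {k | group k = m} → ℝ, (∀ k, 0 < p k) ∧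
      A.submatrix Subtype.val Subtype.val *ᵥ p = p := fun m =>
    have := (hgroup.connected m).nonempty
    exists_pos_mulVec_eq_self_of_preconnected (hA.submatrix_mem_colStochastic m)
      (hgroup.connected m).preconnected
      fun l k hlk => hA.pos _ _ ⟨Or.inr hlk, l.2.trans k.2.symm⟩
  choose p hp hfix using perron
  refine ⟨fun k => p (group k) ⟨k, rfl⟩, fun k => hp _ _, funext fun l => ?_⟩
  have hval : ∀ k m (hm : group k = m), p (group k) ⟨k, rfl⟩ = p m ⟨k, hm⟩ := by
    rintro k _ rfl
    rfl
  calc ∑ k, A l k * p (group k) ⟨k, rfl⟩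
      = ∑ k : {k | group k = group l}, A l k * p (group k) ⟨k, rfl⟩ :=
        (sum_fiber_eq_sum group fun k hk => by
          rw [hA.eq_zero_of_group_ne (Ne.symm hk), zero_mul]).symm
    _ = ∑ k : {k | group k = group l}, A l k * p (group l) k :=
        Finset.sum_congr rfl fun k _ => by rw [hval k (group l) k.2]
    _ = p (group l) ⟨l, rfl⟩ := congrFun (hfix (group l)) ⟨l, rfl⟩

theorem IsCombination.combineOp_eq_self (hA : IsCombination graph group A)
    (hgroup : IsGrouping graph group wo) : combineOp A wo = wo := by
  ext1 k
  have hterm : ∀ l, A l k • wo l = A l k • wo k := fun l => by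
    by_cases h : group l = group k
    · rw [hgroup.same_cluster l k h]
    · rw [hA.eq_zero_of_group_ne h, zero_smul, zero_smul]
  rw [combineOp_apply, Finset.sum_congr rfl fun l _ => hterm l, ← Finset.sum_smul, hA.sum_eq_one,
    one_smul]

end Combination

section NetworkOperators

theorem stepOp_apply (μ : Fin N → ℝ) (v : NetSpace N M) (k : Fin N) :
    stepOp μ v k = μ k • v k := rfl

theorem norm_le_mul_norm_of_forall_apply_le {x y : NetSpace N M} {c : ℝ} (hc : 0 ≤ c)
    (h : ∀ k, ‖y k‖ ≤ c * ‖x k‖) : ‖y‖ ≤ c * ‖x‖ := by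
  refine le_of_sq_le_sq ?_ (by positivity)
  rw [mul_pow, PiLp.norm_sq_eq_of_L2, PiLp.norm_sq_eq_of_L2, Finset.mul_sum]
  refine Finset.sum_le_sum fun k _ => ?_
  rw [← mul_pow]
  exact pow_le_pow_left₀ (norm_nonneg _) (h k) 2

theorem norm_stepOp_le {μ : Fin N → ℝ} {t : ℝ} (ht : 0 ≤ t) (hμ : ∀ k, |μ k| ≤ t)
    (v : NetSpace N M) : ‖stepOp μ v‖ ≤ t * ‖v‖ :=
  norm_le_mul_norm_of_forall_apply_le ht fun k => by
    rw [stepOp_apply, norm_smul, Real.norm_eq_abs]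
    exact mul_le_mul_of_nonneg_right (hμ k) (norm_nonneg _)

theorem exists_norm_le_mul_norm_stepOp {r : Fin N → ℝ} (hr : ∀ k, r k ≠ 0) :
    ∃ K : ℝ, 0 ≤ K ∧ ∀ x : NetSpace N M, ‖x‖ ≤ K * ‖stepOp r x‖ := by
  have hK : 0 ≤ ∑ k, |(r k)⁻¹| := Finset.sum_nonneg fun k _ => abs_nonneg _
  refine ⟨∑ k, |(r k)⁻¹|, hK, fun x => norm_le_mul_norm_of_forall_apply_le hK fun k => ?_⟩
  calc ‖x k‖ = |(r k)⁻¹| * ‖stepOp r x k‖ := by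
        rw [← Real.norm_eq_abs, ← norm_smul, stepOp_apply, inv_smul_smul₀ (hr k)]
    _ ≤ _ := mul_le_mul_of_nonneg_right
        (Finset.single_le_sum (fun j _ => abs_nonneg (r j)⁻¹) (Finset.mem_univ k)) (norm_nonneg _)

end NetworkOperators

section WeightedNorm

theorem sum_weight_norm_sq_sub {ι E : Type*} [Fintype ι] [NormedAddCommGroup E]
    [InnerProductSpace ℝ E] {w : ι → ℝ} (hw : ∑ l, w l = 1) (y : ι → E) :
    ∑ l, w l * ‖y l - ∑ j, w j • y j‖ ^ 2 = ∑ l, w l * ‖y l‖ ^ 2 - ‖∑ j, w j • y j‖ ^ 2 := by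
  have hinner : ∑ l, w l * inner ℝ (y l) (∑ j, w j • y j) = ‖∑ j, w j • y j‖ ^ 2 := by
    simp only [← real_inner_smul_left, ← sum_inner, real_inner_self_eq_norm_sq]
  calc ∑ l, w l * ‖y l - ∑ j, w j • y j‖ ^ 2
      = ∑ l, (w l * ‖y l‖ ^ 2 - 2 * (w l * inner ℝ (y l) (∑ j, w j • y j))
          + w l * ‖∑ j, w j • y j‖ ^ 2) :=
        Finset.sum_congr rfl fun l _ => by rw [norm_sub_sq_real]; ring
    _ = _ := by
        rw [Finset.sum_add_distrib, Finset.sum_sub_distrib, ← Finset.mul_sum, ← Finset.sum_mul,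
          hinner, hw]
        ring

theorem exists_pos_mul_norm_sq_le {E : Type*} [NormedAddCommGroup E] [NormedSpace ℝ E]
    [FiniteDimensional ℝ E] {Q : E → ℝ} (hQ : Continuous Q)
    (hsmul : ∀ (c : ℝ) y, Q (c • y) = c ^ 2 * Q y) (hpos : ∀ y, y ≠ 0 → 0 < Q y) :
    ∃ δ : ℝ, 0 < δ ∧ ∀ y, δ * ‖y‖ ^ 2 ≤ Q y := by
  have hQ0 : Q 0 = 0 := by simpa using hsmul 0 0
  rcases subsingleton_or_nontrivial E with hE | hE
  · exact ⟨1, one_pos, fun y => by simp [Subsingleton.elim y 0, hQ0]⟩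
  obtain ⟨z, hz, hmin⟩ := (isCompact_sphere (0 : E) 1).exists_isMinOn
    (NormedSpace.sphere_nonempty.2 zero_le_one) hQ.continuousOn
  refine ⟨Q z, hpos z (ne_zero_of_mem_unit_sphere ⟨z, hz⟩), fun y => ?_⟩
  by_cases hy : y = 0
  · simp [hy, hQ0]
  have hy' : ‖y‖ ≠ 0 := norm_ne_zero_iff.2 hy
  have hunit : Q z ≤ Q (‖y‖⁻¹ • y) := hmin (by simp [norm_smul, hy'])
  calc Q z * ‖y‖ ^ 2 ≤ (‖y‖⁻¹ ^ 2 * Q y) * ‖y‖ ^ 2 := by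
        rw [← hsmul]
        gcongr
    _ = Q y := by field_simp

/-- The squared norm `∑ k, p_k ‖x_k‖²` of a network vector with weights `p_k` on the agents. For
the Perron weights `A p = p` it does not increase under combination. -/
noncomputable def weightedNormSq (p : Fin N → ℝ) (x : NetSpace N M) : ℝ :=
  ∑ k, p k * ‖x k‖ ^ 2

/-- The weighted dispersion `∑ k, p_k ∑ ℓ, a_{ℓk} ‖y_ℓ - (𝒜ᵀy)_k‖²` of the vectors averaged in a
combination step around their averages: the deficit in Jensen's inequality. -/
noncomputable def dispersion (A : Matrix (Fin N) (Fin N) ℝ) (p : Fin N → ℝ)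
    (y : NetSpace N M) : ℝ :=
  ∑ k, p k * ∑ l, A l k * ‖y l - combineOp A y k‖ ^ 2

variable {A : Matrix (Fin N) (Fin N) ℝ} {p lam μ : Fin N → ℝ} {x y : NetSpace N M}

theorem weightedNormSq_nonneg (hp : ∀ k, 0 ≤ p k) (x : NetSpace N M) : 0 ≤ weightedNormSq p x :=
  Finset.sum_nonneg fun k _ => mul_nonneg (hp k) (sq_nonneg _)

theorem weightedNormSq_eq_zero_iff (hp : ∀ k, 0 ≤ p k) :
    weightedNormSq p x = 0 ↔ ∀ k, p k = 0 ∨ x k = 0 := by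
  simp [weightedNormSq,
    Finset.sum_eq_zero_iff_of_nonneg fun k _ => mul_nonneg (hp k) (sq_nonneg ‖x k‖)]

theorem norm_stepOp_sqrt_sq (hp : ∀ k, 0 ≤ p k) (x : NetSpace N M) :
    ‖stepOp (fun k => √(p k)) x‖ ^ 2 = weightedNormSq p x := by
  rw [PiLp.norm_sq_eq_of_L2]
  refine Finset.sum_congr rfl fun k _ => ?_
  rw [stepOp_apply, norm_smul, mul_pow, Real.norm_eq_abs, sq_abs, Real.sq_sqrt (hp k)]

theorem weightedNormSq_le_sum_mul (hp : ∀ k, 0 ≤ p k) (x : NetSpace N M) :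
    weightedNormSq p x ≤ (∑ k, p k) * ‖x‖ ^ 2 := by
  rw [weightedNormSq, PiLp.norm_sq_eq_of_L2, Finset.mul_sum]
  gcongr with k
  exact Finset.single_le_sum (fun j _ => hp j) (Finset.mem_univ k)

theorem weightedNormSq_combineOp_add_dispersion (hA : ∀ k, ∑ l, A l k = 1) (hfix : A *ᵥ p = p)
    (y : NetSpace N M) :
    weightedNormSq p (combineOp A y) + dispersion A p y = weightedNormSq p y := by
  have hvar : ∀ k, ∑ l, A l k * ‖y l - combineOp A y k‖ ^ 2
      = ∑ l, A l k * ‖y l‖ ^ 2 - ‖combineOp A y k‖ ^ 2 := fun k => by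
    rw [combineOp_apply]
    exact sum_weight_norm_sq_sub (hA k) _
  have hswap : ∑ k, p k * ∑ l, A l k * ‖y l‖ ^ 2 = ∑ l, (A *ᵥ p) l * ‖y l‖ ^ 2 := by
    simp only [Finset.mul_sum, Matrix.mulVec, dotProduct, Finset.sum_mul]
    rw [Finset.sum_comm]
    exact Finset.sum_congr rfl fun l _ => Finset.sum_congr rfl fun k _ => by ring
  simp only [dispersion, hvar, mul_sub, Finset.sum_sub_distrib, hswap, hfix, weightedNormSq]
  ring

theorem dispersion_nonneg (hA : ∀ l k, 0 ≤ A l k) (hp : ∀ k, 0 ≤ p k) (y : NetSpace N M) :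
    0 ≤ dispersion A p y :=
  Finset.sum_nonneg fun k _ => mul_nonneg (hp k) <|
    Finset.sum_nonneg fun l _ => mul_nonneg (hA l k) (sq_nonneg _)

theorem eq_combineOp_of_dispersion_eq_zero (hA : ∀ l k, 0 ≤ A l k) (hp : ∀ k, 0 < p k)
    (hy : dispersion A p y = 0) {l k : Fin N} (hlk : 0 < A l k) : y l = combineOp A y k := by
  have hinner : ∀ k, 0 ≤ ∑ l, A l k * ‖y l - combineOp A y k‖ ^ 2 := fun k =>
    Finset.sum_nonneg fun l _ => mul_nonneg (hA l k) (sq_nonneg _)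
  have hk := (Finset.sum_eq_zero_iff_of_nonneg fun k _ => mul_nonneg (hp k).le (hinner k)).1 hy k
    (Finset.mem_univ k)
  have hl := (Finset.sum_eq_zero_iff_of_nonneg fun l _ => mul_nonneg (hA l k) (sq_nonneg _)).1
    ((mul_eq_zero_iff_left (hp k).ne').1 hk) l (Finset.mem_univ l)
  simpa [hlk.ne', sub_eq_zero] using hl

variable {graph : SimpleGraph (Fin N)} {group : Fin N → Fin G} {wo : NetSpace N M}

theorem IsCombination.eq_of_dispersion_eq_zero (hA : IsCombination graph group A)
    (hgroup : IsGrouping graph group wo) (hp : ∀ k, 0 < p k) (hy : dispersion A p y = 0)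
    {l s : Fin N} (hls : group l = group s) : y l = y s := by
  have heq : ∀ {l k : Fin N}, 0 < A l k → y l = combineOp A y k :=
    eq_combineOp_of_dispersion_eq_zero hA.mem_colStochastic.1 hp hy
  have hadj : ∀ a b : {k | group k = group s},
      (graph.induce {k | group k = group s}).Adj a b → y a = y b := fun a b hab =>
    (heq (hA.pos a b ⟨Or.inr hab, a.2.trans b.2.symm⟩)).trans
      (heq (hA.pos b b ⟨Or.inl rfl, rfl⟩)).symm
  exact eq_of_preconnected_of_adj (hgroup.connected (group s)).preconnected
    (f := fun k => y k) hadj ⟨l, hls⟩ ⟨s, rfl⟩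

theorem IsCombination.exists_pos_le_dispersion_add (hA : IsCombination graph group A)
    (hgroup : IsGrouping graph group wo) (hp : ∀ k, 0 < p k) (hlam : ∀ k, 0 ≤ lam k)
    (hstrong : ∀ m, ∃ k, group k = m ∧ 0 < lam k) :
    ∃ δ : ℝ, 0 < δ ∧ ∀ y : NetSpace N M,
      δ * ‖y‖ ^ 2 ≤ dispersion A p y + weightedNormSq (p * lam) y := by
  have hplam : ∀ k, 0 ≤ (p * lam) k := fun k => mul_nonneg (hp k).le (hlam k)
  refine exists_pos_mul_norm_sq_le ?_ (fun c y => ?_) fun y hy => ?_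
  · have := (combineOp (M := M) A).continuous
    unfold dispersion weightedNormSq
    fun_prop
  · simp only [dispersion, weightedNormSq, map_smul, PiLp.smul_apply, ← smul_sub, norm_smul,
      mul_pow, Real.norm_eq_abs, sq_abs, mul_add, Finset.mul_sum, mul_left_comm (c ^ 2)]
  · have hdisp := dispersion_nonneg hA.mem_colStochastic.1 (fun k => (hp k).le) y
    have hgrad := weightedNormSq_nonneg hplam y
    refine (add_nonneg hdisp hgrad).lt_of_ne' fun h0 => hy ?_
    obtain ⟨hdisp0, hgrad0⟩ := (add_eq_zero_iff_of_nonneg hdisp hgrad).1 h0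
    ext1 l
    obtain ⟨s, hs, hlams⟩ := hstrong (group l)
    rw [hA.eq_of_dispersion_eq_zero hgroup hp hdisp0 hs.symm]
    exact ((weightedNormSq_eq_zero_iff hplam).1 hgrad0 s).resolve_left
      (mul_pos (hp s) hlams).ne'

theorem weightedNormSq_add_le (hp : ∀ k, 0 ≤ p k) (hlam : ∀ k, 0 ≤ lam k) {s : ℝ} (hs : 0 ≤ s)
    (hμ : ∀ k, s ≤ μ k) (hμlam : ∀ k, μ k * lam k ≤ 1)
    (hxy : ∀ k, ‖y k‖ ≤ (1 - μ k * lam k) * ‖x k‖) :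
    weightedNormSq p y + s * weightedNormSq (p * lam) y ≤ weightedNormSq p x := by
  rw [weightedNormSq, weightedNormSq, weightedNormSq, Finset.mul_sum, ← Finset.sum_add_distrib]
  refine Finset.sum_le_sum fun k _ => ?_
  have hrate : 0 ≤ μ k * lam k := mul_nonneg (hs.trans (hμ k)) (hlam k)
  have hscalar : (1 + μ k * lam k) * (1 - μ k * lam k) ^ 2 ≤ 1 := by
    nlinarith [hμlam k, mul_nonneg hrate hrate,
      mul_nonneg (mul_nonneg hrate hrate) (sub_nonneg.2 (hμlam k))]
  calc p k * ‖y k‖ ^ 2 + s * ((p * lam) k * ‖y k‖ ^ 2)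
      = p k * ((1 + s * lam k) * ‖y k‖ ^ 2) := by rw [Pi.mul_apply]; ring
    _ ≤ p k * ((1 + μ k * lam k) * ((1 - μ k * lam k) * ‖x k‖) ^ 2) := by
        have := hp k
        have := hlam k
        gcongr
        exacts [hμ k, hxy k]
    _ = p k * (((1 + μ k * lam k) * (1 - μ k * lam k) ^ 2) * ‖x k‖ ^ 2) := by ring
    _ ≤ p k * ‖x k‖ ^ 2 :=
        mul_le_mul_of_nonneg_left (mul_le_of_le_one_left (sq_nonneg _) hscalar) (hp k)

theorem IsCombination.exists_weightedNormSq_combineOp_le (hA : IsCombination graph group A)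
    (hgroup : IsGrouping graph group wo) (hp : ∀ k, 0 < p k) (hfix : A *ᵥ p = p)
    (hlam : ∀ k, 0 ≤ lam k) (hstrong : ∀ m, ∃ k, group k = m ∧ 0 < lam k) :
    ∃ c : ℝ, 0 < c ∧ c ≤ 1 ∧ ∀ (μ : Fin N → ℝ) (s : ℝ), 0 ≤ s → s ≤ 1 → (∀ k, s ≤ μ k) →
      (∀ k, μ k * lam k ≤ 1) → ∀ x y : NetSpace N M,
      (∀ k, ‖y k‖ ≤ (1 - μ k * lam k) * ‖x k‖) →
      weightedNormSq p (combineOp A y) ≤ (1 - c * s) * weightedNormSq p x := by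
  have hp' : ∀ k, 0 ≤ p k := fun k => (hp k).le
  obtain ⟨δ, hδ, hquad⟩ := hA.exists_pos_le_dispersion_add (M := M) hgroup hp hlam hstrong
  have hsum : 0 < ∑ k, p k + 1 := by
    have := Finset.sum_nonneg fun k (_ : k ∈ Finset.univ) => hp' k
    positivity
  have hrate : 0 < min 1 (δ / (∑ k, p k + 1)) := lt_min one_pos (div_pos hδ hsum)
  refine ⟨min 1 (δ / (∑ k, p k + 1)) / 2, half_pos hrate, ?_, ?_⟩
  · linarith [min_le_left 1 (δ / (∑ k, p k + 1))]
  generalize hη : min 1 (δ / (∑ k, p k + 1)) = η at hrate ⊢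
  intro μ s hs hs1 hμ hμlam x y hxy
  have hη1 : η ≤ 1 := hη ▸ min_le_left _ _
  have hstep := weightedNormSq_add_le hp' hlam hs hμ hμlam hxy
  have hjensen := weightedNormSq_combineOp_add_dispersion hA.sum_eq_one hfix y
  have hdisp := dispersion_nonneg hA.mem_colStochastic.1 hp' y
  have hcomb := weightedNormSq_nonneg hp' (combineOp A y)
  have hgain : η * weightedNormSq p (combineOp A y) ≤
      dispersion A p y + weightedNormSq (p * lam) y := by
    calc η * weightedNormSq p (combineOp A y)
        ≤ δ / (∑ k, p k + 1) * ((∑ k, p k + 1) * ‖y‖ ^ 2) := by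
          gcongr
          · exact hη ▸ min_le_right _ _
          · nlinarith [weightedNormSq_le_sum_mul hp' y, sq_nonneg ‖y‖]
      _ = δ * ‖y‖ ^ 2 := by field_simp
      _ ≤ _ := hquad y
  have hmain : (1 + η * s) * weightedNormSq p (combineOp A y) ≤ weightedNormSq p x := by
    nlinarith [mul_le_mul_of_nonneg_left hgain hs, mul_le_mul_of_nonneg_right hs1 hdisp]
  have hηs : η * s ≤ 1 := mul_le_one₀ hη1 hs hs1
  have hinv : 1 ≤ (1 - η / 2 * s) * (1 + η * s) := by nlinarith [mul_nonneg hrate.le hs]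
  calc weightedNormSq p (combineOp A y)
      ≤ ((1 - η / 2 * s) * (1 + η * s)) * weightedNormSq p (combineOp A y) :=
        le_mul_of_one_le_left hcomb hinv
    _ = (1 - η / 2 * s) * ((1 + η * s) * weightedNormSq p (combineOp A y)) := by ring
    _ ≤ _ := mul_le_mul_of_nonneg_left hmain (by linarith)

end WeightedNorm

section GradientStep

variable {E : Type*} [NormedAddCommGroup E] [InnerProductSpace ℝ E]

theorem norm_le_of_abs_inner_self_le {T : E →L[ℝ] E} (hT : T.IsSymmetric) {c : ℝ} (hc : 0 ≤ c)
    (h : ∀ v, |inner ℝ (T v) v| ≤ c * ‖v‖ ^ 2) : ‖T‖ ≤ c := by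
  rw [T.norm_eq_iSup_rayleighQuotient hT]
  refine ciSup_le fun v => ?_
  rw [ContinuousLinearMap.rayleighQuotient, ContinuousLinearMap.reApplyInnerSelf_apply, abs_div,
    abs_sq]
  exact div_le_of_le_mul₀ (sq_nonneg _) hc (h v)

variable [CompleteSpace E] {f : E → ℝ} {w z : E} {a b s κ : ℝ}

theorem isSymmetric_fderiv_gradient (hf : Differentiable ℝ f)
    (hg : DifferentiableAt ℝ (gradient f) w) : (fderiv ℝ (gradient f) w).IsSymmetric := by
  intro u v
  have hfirst : ∀ y, HasFDerivAt f (innerSL ℝ (gradient f y)) y :=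
    fun y => (hf y).hasGradientAt.hasFDerivAt
  have hsecond : HasFDerivAt (fun y => innerSL ℝ (gradient f y))
      ((innerSL ℝ : E →L[ℝ] E →L[ℝ] ℝ) ∘L fderiv ℝ (gradient f) w) w :=
    (innerSL ℝ : E →L[ℝ] E →L[ℝ] ℝ).hasFDerivAt.comp w hg.hasFDerivAt
  exact (second_derivative_symmetric hfirst hsecond u v).trans (real_inner_comm _ _)

theorem norm_id_sub_smul_fderiv_gradient_le (hf : Differentiable ℝ f)
    (hg : DifferentiableAt ℝ (gradient f) w)
    (hlow : ∀ v, a * ‖v‖ ^ 2 ≤ inner ℝ (fderiv ℝ (gradient f) w v) v)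
    (hupp : ∀ v, inner ℝ (fderiv ℝ (gradient f) w v) v ≤ b * ‖v‖ ^ 2) (hs : 0 ≤ s) (hab : a ≤ b)
    (hsb : s * b ≤ 1) :
    ‖ContinuousLinearMap.id ℝ E - s • fderiv ℝ (gradient f) w‖ ≤ 1 - s * a := by
  have hsa : s * a ≤ s * b := mul_le_mul_of_nonneg_left hab hs
  refine norm_le_of_abs_inner_self_le (fun u v => ?_) (by linarith) fun v => ?_
  · have hsymm : inner ℝ (fderiv ℝ (gradient f) w u) v = inner ℝ u (fderiv ℝ (gradient f) w v) :=
      isSymmetric_fderiv_gradient hf hg u v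
    change inner ℝ (u - s • fderiv ℝ (gradient f) w u) v
      = inner ℝ u (v - s • fderiv ℝ (gradient f) w v)
    rw [inner_sub_left, inner_sub_right, real_inner_smul_left, real_inner_smul_right, hsymm]
  · change |inner ℝ (v - s • fderiv ℝ (gradient f) w v) v| ≤ _
    rw [inner_sub_left, real_inner_smul_left, real_inner_self_eq_norm_sq, abs_le]
    have hnonneg : 0 ≤ (1 - s * b) * ‖v‖ ^ 2 := mul_nonneg (by linarith) (sq_nonneg _)
    constructor <;> nlinarith [mul_le_mul_of_nonneg_left (hlow v) hs,
      mul_le_mul_of_nonneg_left (hupp v) hs, mul_le_mul_of_nonneg_right hsa (sq_nonneg ‖v‖)]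

theorem gradient_eq_zero_of_isLocalMin (h : IsLocalMin f z) : gradient f z = 0 := by
  rw [gradient, h.fderiv_eq_zero, map_zero]

theorem norm_add_smul_gradient_sub_le (hf : Differentiable ℝ f)
    (hg : Differentiable ℝ (gradient f))
    (hlow : ∀ w v, a * ‖v‖ ^ 2 ≤ inner ℝ (fderiv ℝ (gradient f) w v) v)
    (hupp : ∀ w v, inner ℝ (fderiv ℝ (gradient f) w v) v ≤ b * ‖v‖ ^ 2) (hs : 0 ≤ s) (hab : a ≤ b)
    (hsb : s * b ≤ 1) (hz : gradient f z = 0) (x : E) :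
    ‖x + s • gradient f (z - x)‖ ≤ (1 - s * a) * ‖x‖ := by
  have hderiv : ∀ w, HasFDerivAt (fun w => w - s • gradient f w)
      (ContinuousLinearMap.id ℝ E - s • fderiv ℝ (gradient f) w) w :=
    fun w => (hasFDerivAt_id w).sub ((hg w).hasFDerivAt.const_smul s)
  have hlip := convex_univ.norm_image_sub_le_of_norm_hasFDerivWithin_le (𝕜 := ℝ)
    (fun w _ => (hderiv w).hasFDerivWithinAt)
    (fun w _ => norm_id_sub_smul_fderiv_gradient_le hf (hg w) (hlow w) (hupp w) hs hab hsb)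
    (Set.mem_univ (z - x)) (Set.mem_univ z)
  have hdiff : z - s • gradient f z - (z - x - s • gradient f (z - x))
      = x + s • gradient f (z - x) := by
    rw [hz, smul_zero]
    abel
  rwa [hdiff, sub_sub_cancel] at hlip

theorem norm_gradient_sub_add_fderiv_le (hg : Differentiable ℝ (gradient f)) (hκ : 0 ≤ κ)
    (hlip : ∀ w, ‖fderiv ℝ (gradient f) w - fderiv ℝ (gradient f) z‖ ≤ κ * ‖w - z‖)
    (hz : gradient f z = 0) (x : E) :
    ‖gradient f (z - x) + fderiv ℝ (gradient f) z x‖ ≤ κ * ‖x‖ ^ 2 := by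
  have hball : ∀ w ∈ Metric.closedBall z ‖x‖,
      ‖fderiv ℝ (gradient f) w - fderiv ℝ (gradient f) z‖ ≤ κ * ‖x‖ := fun w hw =>
    (hlip w).trans (mul_le_mul_of_nonneg_left (mem_closedBall_iff_norm.1 hw) hκ)
  have htaylor := (convex_closedBall z ‖x‖).norm_image_sub_le_of_norm_fderiv_le' (𝕜 := ℝ)
    (fun w _ => hg w) hball (Metric.mem_closedBall_self (norm_nonneg x))
    (y := z - x) (by simp)
  simpa [hz, sq, mul_assoc] using htaylor

end GradientStep

section CostFamily

/-- A variant of `IsCostFamily` for costs that need not be strictly convex, in which the Lipschitz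
condition compares each Hessian only with its value at the minimizer of the cost. -/
structure IsConvexCostFamily (group : Fin N → Fin G) (J : Fin N → AgentSpace M → ℝ)
    (wo : NetSpace N M) (lamL lamU : Fin N → ℝ) (κ : ℝ) : Prop where
  differentiable : ∀ k, Differentiable ℝ (J k)
  differentiable_gradient : ∀ k, Differentiable ℝ (gradient (J k))
  minimizer : ∀ k, IsMinOn (J k) Set.univ (wo k)
  lamL_nonneg : ∀ k, 0 ≤ lamL k
  lamL_le_lamU : ∀ k, lamL k ≤ lamU k
  hessian_lower : ∀ k w v, lamL k * ‖v‖ ^ 2 ≤ inner ℝ (hessian (J k) w v) v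
  hessian_upper : ∀ k w v, inner ℝ (hessian (J k) w v) v ≤ lamU k * ‖v‖ ^ 2
  exists_strong : ∀ m, ∃ k, group k = m ∧ 0 < lamL k
  κ_nonneg : 0 ≤ κ
  norm_hessian_sub_le : ∀ k w, ‖hessian (J k) w - hessian (J k) (wo k)‖ ≤ κ * ‖w - wo k‖

variable {group : Fin N → Fin G} {J : Fin N → AgentSpace M → ℝ} {wo : NetSpace N M}
  {lamL lamU μ : Fin N → ℝ} {κ : ℝ}

theorem norm_hessian_sub_le_norm_netHessian_sub (J : Fin N → AgentSpace M → ℝ) (k : Fin N)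
    (w₁ w₂ : NetSpace N M) :
    ‖hessian (J k) (w₁ k) - hessian (J k) (w₂ k)‖ ≤ ‖netHessian J w₁ - netHessian J w₂‖ := by
  refine ContinuousLinearMap.opNorm_le_bound _ (norm_nonneg _) fun v => ?_
  have hsingle : (PiLp.single 2 k v : NetSpace N M) k = v :=
    PiLp.single_eq_same (β := fun _ => AgentSpace M) 2 k v
  calc ‖(hessian (J k) (w₁ k) - hessian (J k) (w₂ k)) v‖
      = ‖((netHessian J w₁ - netHessian J w₂) (PiLp.single 2 k v : NetSpace N M)) k‖ := by
        nth_rw 1 [← hsingle]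
        rfl
    _ ≤ ‖(netHessian J w₁ - netHessian J w₂) (PiLp.single 2 k v : NetSpace N M)‖ :=
        PiLp.norm_apply_le _ k
    _ ≤ ‖netHessian J w₁ - netHessian J w₂‖ * ‖(PiLp.single 2 k v : NetSpace N M)‖ :=
        ContinuousLinearMap.le_opNorm _ _
    _ = ‖netHessian J w₁ - netHessian J w₂‖ * ‖v‖ := by rw [PiLp.norm_single]

theorem IsCostFamily.isConvexCostFamily (hJ : IsCostFamily group J wo lamL lamU κ) :
    IsConvexCostFamily group J wo lamL lamU κ where
  __ := hJ
  κ_nonneg := hJ.κH_nonneg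
  norm_hessian_sub_le k w := by
    have h := (norm_hessian_sub_le_norm_netHessian_sub J k
      (wo + PiLp.single 2 k (w - wo k) : NetSpace N M) wo).trans (hJ.lipschitz _ _)
    simpa using h

/-- The stacked gradient `∇J(w) = col{∇J_1(w_1), …, ∇J_N(w_N)}`. -/
noncomputable def netGradient (J : Fin N → AgentSpace M → ℝ) (w : NetSpace N M) : NetSpace N M :=
  WithLp.toLp 2 fun k => gradient (J k) (w k)

/-- The map `x ↦ x + ℳ ∇J(wo - x)`: the noise-free adaptation step, expressed in terms of the
network error. -/
noncomputable def errorStep (μ : Fin N → ℝ) (J : Fin N → AgentSpace M → ℝ) (wo x : NetSpace N M) :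
    NetSpace N M :=
  x + stepOp μ (netGradient J (wo - x))

theorem continuous_netGradient (hg : ∀ k, Continuous (gradient (J k))) :
    Continuous (netGradient J) :=
  (PiLp.continuous_toLp 2 _).comp
    (continuous_pi fun k => (hg k).comp (PiLp.continuous_apply 2 _ k))

namespace IsConvexCostFamily

theorem gradient_eq_zero (hJ : IsConvexCostFamily group J wo lamL lamU κ) (k : Fin N) :
    gradient (J k) (wo k) = 0 :=
  gradient_eq_zero_of_isLocalMin ((hJ.minimizer k).isLocalMin univ_mem)

theorem norm_errorStep_apply_le (hJ : IsConvexCostFamily group J wo lamL lamU κ)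
    (hμ : ∀ k, 0 ≤ μ k) (hμU : ∀ k, μ k * lamU k ≤ 1) (x : NetSpace N M) (k : Fin N) :
    ‖errorStep μ J wo x k‖ ≤ (1 - μ k * lamL k) * ‖x k‖ :=
  norm_add_smul_gradient_sub_le (hJ.differentiable k) (hJ.differentiable_gradient k)
    (hJ.hessian_lower k) (hJ.hessian_upper k) (hμ k) (hJ.lamL_le_lamU k) (hμU k)
    (hJ.gradient_eq_zero k) (x k)

theorem norm_sub_stepOp_netHessian_apply_le (hJ : IsConvexCostFamily group J wo lamL lamU κ)
    (hμ : ∀ k, 0 ≤ μ k) (hμU : ∀ k, μ k * lamU k ≤ 1) (x : NetSpace N M) (k : Fin N) :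
    ‖(x - stepOp μ (netHessian J wo x)) k‖ ≤ (1 - μ k * lamL k) * ‖x k‖ :=
  ContinuousLinearMap.le_of_opNorm_le
    (f := ContinuousLinearMap.id ℝ (AgentSpace M) - μ k • hessian (J k) (wo k))
    (norm_id_sub_smul_fderiv_gradient_le (hJ.differentiable k)
      (hJ.differentiable_gradient k _) (hJ.hessian_lower k _) (hJ.hessian_upper k _) (hμ k)
      (hJ.lamL_le_lamU k) (hμU k)) (x k)

theorem norm_netGradient_sub_add_netHessian_le (hJ : IsConvexCostFamily group J wo lamL lamU κ)
    (x : NetSpace N M) :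
    ‖netGradient J (wo - x) + netHessian J wo x‖ ≤ κ * ‖x‖ ^ 2 := by
  have hκ := hJ.κ_nonneg
  rw [sq, ← mul_assoc]
  refine norm_le_mul_norm_of_forall_apply_le (by positivity) fun k => ?_
  calc ‖gradient (J k) (wo k - x k) + hessian (J k) (wo k) (x k)‖ ≤ κ * ‖x k‖ ^ 2 :=
        norm_gradient_sub_add_fderiv_le (hJ.differentiable_gradient k) hκ
          (hJ.norm_hessian_sub_le k) (hJ.gradient_eq_zero k) (x k)
    _ ≤ κ * ‖x‖ * ‖x k‖ := by
        rw [sq, ← mul_assoc]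
        gcongr
        exact PiLp.norm_apply_le x k

end IsConvexCostFamily

/-- One-step estimates in the norm `‖R ·‖`: the noise-free error recursion and the long-term
model contract its square by the factor `1 - q`, the noise is amplified by at most `g`, and the
norm dominates `K⁻¹ ‖·‖`. -/
structure StepEstimates (R : NetSpace N M →L[ℝ] NetSpace N M) (A : Matrix (Fin N) (Fin N) ℝ)
    (μ : Fin N → ℝ) (J : Fin N → AgentSpace M → ℝ) (wo : NetSpace N M) (q g K : ℝ) : Prop where
  q_pos : 0 < q
  q_le_one : q ≤ 1
  g_nonneg : 0 ≤ g
  K_nonneg : 0 ≤ K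
  contract : ∀ x, ‖R (combineOp A (errorStep μ J wo x))‖ ^ 2 ≤ (1 - q) * ‖R x‖ ^ 2
  contract_long : ∀ x, ‖R (longOp A μ J wo x)‖ ^ 2 ≤ (1 - q) * ‖R x‖ ^ 2
  noise : ∀ v, ‖R (combineOp A (stepOp μ v))‖ ≤ g * ‖v‖
  lower : ∀ x, ‖x‖ ≤ K * ‖R x‖

theorem exists_pos_mul_le_one {ι : Type*} [Finite ι] (U : ι → ℝ) :
    ∃ t₀ : ℝ, 0 < t₀ ∧ ∀ t, 0 ≤ t → t ≤ t₀ → ∀ k, t * U k ≤ 1 := by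
  obtain ⟨C, hC⟩ := (Set.finite_range U).bddAbove
  refine ⟨(|C| + 1)⁻¹, by positivity, fun t ht htt₀ k => ?_⟩
  calc t * U k ≤ t * (|C| + 1) := by
        gcongr
        linarith [hC (Set.mem_range_self k), le_abs_self C]
    _ ≤ 1 := by rwa [← le_div_iff₀ (by positivity), one_div]

theorem IsConvexCostFamily.exists_stepEstimates {graph : SimpleGraph (Fin N)}
    {A : Matrix (Fin N) (Fin N) ℝ} {τ : ℝ} (hJ : IsConvexCostFamily group J wo lamL lamU κ)
    (hgroup : IsGrouping graph group wo) (hA : IsCombination graph group A) (hτ : 0 < τ) :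
    ∃ (R : NetSpace N M →L[ℝ] NetSpace N M) (c K t₀ : ℝ), 0 < c ∧ 0 < t₀ ∧
      ∀ (μ : Fin N → ℝ) (t : ℝ), 0 < t → t ≤ t₀ → (∀ k, τ * t ≤ μ k) → (∀ k, μ k ≤ t) →
        StepEstimates R A μ J wo (c * t) (K * t) K := by
  obtain ⟨p, hp, hfix⟩ := hA.exists_pos_mulVec_eq_self hgroup
  obtain ⟨c, hc, hc1, hcontract⟩ := hA.exists_weightedNormSq_combineOp_le (M := M) hgroup hp hfix
    hJ.lamL_nonneg hJ.exists_strong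
  obtain ⟨K, hK, hlower⟩ := exists_norm_le_mul_norm_stepOp (M := M)
    fun k => (Real.sqrt_pos.2 (hp k)).ne'
  set R : NetSpace N M →L[ℝ] NetSpace N M := stepOp fun k => √(p k)
  obtain ⟨t₁, ht₁, hsmall⟩ := exists_pos_mul_le_one lamU
  refine ⟨R, c * τ, K + ‖R ∘L combineOp A‖, min t₁ τ⁻¹, mul_pos hc hτ,
    lt_min ht₁ (inv_pos.2 hτ), fun μ t ht htt₀ hτμ hμt => ?_⟩
  have hτt : τ * t ≤ 1 :=
    (le_inv_mul_iff₀ hτ).1 (by simpa using htt₀.trans (min_le_right _ _))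
  have hμ : ∀ k, 0 ≤ μ k := fun k => (by positivity : 0 ≤ τ * t).trans (hτμ k)
  have hμU : ∀ k, μ k * lamU k ≤ 1 := fun k =>
    hsmall (μ k) (hμ k) ((hμt k).trans (htt₀.trans (min_le_left _ _))) k
  have hμL : ∀ k, μ k * lamL k ≤ 1 := fun k =>
    (mul_le_mul_of_nonneg_left (hJ.lamL_le_lamU k) (hμ k)).trans (hμU k)
  have hR : ∀ x y : NetSpace N M, (∀ k, ‖y k‖ ≤ (1 - μ k * lamL k) * ‖x k‖) →
      ‖R (combineOp A y)‖ ^ 2 ≤ (1 - c * τ * t) * ‖R x‖ ^ 2 := fun x y hxy => by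
    rw [norm_stepOp_sqrt_sq fun k => (hp k).le, norm_stepOp_sqrt_sq fun k => (hp k).le, mul_assoc]
    exact hcontract μ (τ * t) (by positivity) hτt hτμ hμL x y hxy
  have hct1 : c * τ * t ≤ 1 := by
    rw [mul_assoc]
    exact mul_le_one₀ hc1 (by positivity) hτt
  refine ⟨by positivity, hct1, by positivity, by positivity,
    fun x => hR x _ (hJ.norm_errorStep_apply_le hμ hμU x),
    fun x => hR x _ (hJ.norm_sub_stepOp_netHessian_apply_le hμ hμU x), fun v => ?_, fun x => ?_⟩
  · calc ‖R (combineOp A (stepOp μ v))‖ ≤ ‖R ∘L combineOp A‖ * ‖stepOp μ v‖ :=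
          (R ∘L combineOp A).le_opNorm _
      _ ≤ (K + ‖R ∘L combineOp A‖) * (t * ‖v‖) := by
          gcongr
          · exact le_add_of_nonneg_left hK
          · exact norm_stepOp_le ht.le (fun k => (abs_of_nonneg (hμ k)).trans_le (hμt k)) v
      _ = (K + ‖R ∘L combineOp A‖) * t * ‖v‖ := by ring
  · exact (hlower x).trans
      (mul_le_mul_of_nonneg_right (le_add_of_nonneg_right (norm_nonneg _)) (norm_nonneg _))

end CostFamily

section Moments

theorem norm_add_sq_le {E : Type*} [SeminormedAddCommGroup E] (u v : E) {η : ℝ} (hη : 0 < η) :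
    ‖u + v‖ ^ 2 ≤ (1 + η) * ‖u‖ ^ 2 + (1 + 1 / η) * ‖v‖ ^ 2 := by
  have hyoung : (η * ‖u‖ - ‖v‖) ^ 2 / η = η * ‖u‖ ^ 2 + 1 / η * ‖v‖ ^ 2 - 2 * (‖u‖ * ‖v‖) := by
    field_simp
    ring
  have hsq : 0 ≤ (η * ‖u‖ - ‖v‖) ^ 2 / η := by positivity
  nlinarith [pow_le_pow_left₀ (norm_nonneg _) (norm_add_le u v) 2]

theorem norm_add_sq_le_of_contract {E E' : Type*} [SeminormedAddCommGroup E]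
    [SeminormedAddCommGroup E'] {u v : E} {x : E'} {q : ℝ} (hq : 0 < q) (hq1 : q ≤ 1)
    (hu : ‖u‖ ^ 2 ≤ (1 - q) * ‖x‖ ^ 2) :
    ‖u + v‖ ^ 2 ≤ (1 - q / 2) * ‖x‖ ^ 2 + 3 / q * ‖v‖ ^ 2 := by
  refine (norm_add_sq_le u v (half_pos hq)).trans (add_le_add ?_ ?_)
  · nlinarith [mul_le_mul_of_nonneg_left hu (by positivity : 0 ≤ 1 + q / 2),
      mul_nonneg (sq_nonneg q) (sq_nonneg ‖x‖)]
  · gcongr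
    rw [le_div_iff₀ hq]
    field_simp
    linarith

variable {Ω E : Type*} {m mΩ : MeasurableSpace Ω} {P : Measure Ω} [NormedAddCommGroup E]

theorem integrable_norm_pow_four {f : Ω → E} (hf : MemLp f 4 P) :
    Integrable (fun ω => ‖f ω‖ ^ 4) P :=
  hf.integrable_norm_pow four_ne_zero

theorem integrable_norm_sq {f : Ω → E} (hf : MemLp f 2 P) :
    Integrable (fun ω => ‖f ω‖ ^ 2) P :=
  hf.integrable_norm_pow two_ne_zero

theorem integral_norm_pow_le_of_norm_le {E' : Type*} [NormedAddCommGroup E'] {p : ℕ} (hp : p ≠ 0)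
    {f : Ω → E} {h : Ω → E'} (hh : MemLp h p P) {C : ℝ} (hfh : ∀ ω, ‖f ω‖ ≤ C * ‖h ω‖) :
    ∫ ω, ‖f ω‖ ^ p ∂P ≤ C ^ p * ∫ ω, ‖h ω‖ ^ p ∂P := by
  rw [← integral_const_mul]
  refine integral_mono_of_nonneg (ae_of_all _ fun ω => by positivity)
    ((hh.integrable_norm_pow hp).const_mul _) (ae_of_all _ fun ω => ?_)
  simpa only [mul_pow] using pow_le_pow_left₀ (norm_nonneg _) (hfh ω) p

theorem limsup_lintegral_enorm_sq_le {f : ℕ → Ω → E} (hf : ∀ n, MemLp (f n) 2 P) {u : ℕ → ℝ}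
    {B : ℝ} (hu : Tendsto u atTop (𝓝 B)) (hfu : ∀ n, ∫ ω, ‖f n ω‖ ^ 2 ∂P ≤ u n) :
    limsup (fun n => ∫⁻ ω, ‖f n ω‖ₑ ^ 2 ∂P) atTop ≤ ENNReal.ofReal B := by
  have hle : ∀ n, ∫⁻ ω, ‖f n ω‖ₑ ^ 2 ∂P ≤ ENNReal.ofReal (u n) := fun n =>
    calc ∫⁻ ω, ‖f n ω‖ₑ ^ 2 ∂P = ∫⁻ ω, ENNReal.ofReal (‖f n ω‖ ^ 2) ∂P := by
          simp only [ENNReal.ofReal_pow (norm_nonneg _), ofReal_norm]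
      _ = ENNReal.ofReal (∫ ω, ‖f n ω‖ ^ 2 ∂P) :=
          (ofReal_integral_eq_lintegral_ofReal (integrable_norm_sq (hf n))
            (ae_of_all _ fun ω => by positivity)).symm
      _ ≤ ENNReal.ofReal (u n) := ENNReal.ofReal_le_ofReal (hfu n)
  exact (limsup_le_limsup (Eventually.of_forall hle)).trans
    (ENNReal.tendsto_ofReal hu).limsup_eq.le

theorem condExp_comp_eq_zero {E' : Type*} [NormedAddCommGroup E'] [NormedSpace ℝ E]
    [NormedSpace ℝ E'] [CompleteSpace E] [CompleteSpace E'] (T : E →L[ℝ] E') {f : Ω → E}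
    (hf : Integrable f P) (hcond : P[f | m] =ᵐ[P] 0) : P[fun ω => T (f ω) | m] =ᵐ[P] 0 := by
  refine (T.comp_condExp_comm hf).symm.trans ?_
  filter_upwards [hcond] with ω hω
  rw [Function.comp_apply, hω, Pi.zero_apply, map_zero, Pi.zero_apply]

variable [InnerProductSpace ℝ E]

theorem norm_add_pow_four_le (u v : E) {η : ℝ} (hη : 0 < η) :
    ‖u + v‖ ^ 4 ≤ (1 + η) * ‖u‖ ^ 4 + 4 * inner ℝ (‖u‖ ^ 2 • u) v + (3 + 16 / η) * ‖v‖ ^ 4 := by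
  have hexpand : ‖u + v‖ ^ 4 = (‖u‖ ^ 2 + 2 * inner ℝ u v + ‖v‖ ^ 2) ^ 2 := by
    rw [← norm_add_sq_real]
    ring
  rw [hexpand, real_inner_smul_left]
  have hu := norm_nonneg u
  have hv := norm_nonneg v
  obtain ⟨hlow, hupp⟩ := abs_le.1 (abs_real_inner_le_norm u v)
  generalize inner ℝ u v = i at hlow hupp ⊢
  generalize ‖u‖ = a at hu hlow hupp ⊢
  generalize ‖v‖ = b at hv hlow hupp ⊢
  have hi_sq : i ^ 2 ≤ (a * b) ^ 2 := sq_le_sq' hlow hupp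
  have hi_mul : i * b ^ 2 ≤ a * b * b ^ 2 := mul_le_mul_of_nonneg_right hupp (sq_nonneg b)
  have hyoung : 8 * (a ^ 2 * b ^ 2) ≤ η * a ^ 4 + 16 / η * b ^ 4 := by
    have hsq : (η * a ^ 2 - 4 * b ^ 2) ^ 2 / η
        = η * a ^ 4 + 16 / η * b ^ 4 - 8 * (a ^ 2 * b ^ 2) := by
      field_simp
      ring
    have : 0 ≤ (η * a ^ 2 - 4 * b ^ 2) ^ 2 / η := by positivity
    linarith
  nlinarith [mul_nonneg (sq_nonneg (a - b)) (sq_nonneg b)]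

theorem integrable_inner_norm_sq_smul {u v : Ω → E} (hu : MemLp u 4 P) (hv : MemLp v 4 P) :
    Integrable (fun ω => inner ℝ (‖u ω‖ ^ 2 • u ω) (v ω)) P := by
  refine ((integrable_norm_pow_four hu).add (integrable_norm_pow_four hv)).mono'
    (((hu.1.norm.pow 2).smul hu.1).inner hv.1) (ae_of_all _ fun ω => ?_)
  refine (norm_inner_le_norm _ _).trans ?_
  rw [norm_smul, norm_pow, norm_norm, Pi.add_apply]
  generalize ‖u ω‖ = a
  generalize ‖v ω‖ = b
  nlinarith [sq_nonneg (a ^ 2 - a * b), sq_nonneg (a ^ 2 - b ^ 2), sq_nonneg (a * b),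
    sq_nonneg (b ^ 2), sq_nonneg (a ^ 2)]

theorem integral_inner_eq_zero_of_condExp_eq_zero [CompleteSpace E] (hm : m ≤ mΩ)
    [SigmaFinite (P.trim hm)] {u v : Ω → E} (hu : StronglyMeasurable[m] u)
    (huv : Integrable (fun ω => inner ℝ (u ω) (v ω)) P) (hv : Integrable v P)
    (hcond : P[v | m] =ᵐ[P] 0) : ∫ ω, inner ℝ (u ω) (v ω) ∂P = 0 := by
  have hpull := condExp_bilin_of_stronglyMeasurable_left (m := m)
    (innerSL ℝ : E →L[ℝ] E →L[ℝ] ℝ) hu huv hv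
  rw [← integral_condExp hm]
  refine integral_eq_zero_of_ae ?_
  filter_upwards [hpull, hcond] with ω hω hω0
  refine hω.trans ?_
  rw [hω0]
  simp

theorem integral_norm_add_pow_four_le [IsFiniteMeasure P] [CompleteSpace E] (hm : m ≤ mΩ)
    {u v : Ω → E} (hum : StronglyMeasurable[m] u) (hu : MemLp u 4 P) (hv : MemLp v 4 P)
    (hcond : P[v | m] =ᵐ[P] 0) {η : ℝ} (hη : 0 < η) :
    ∫ ω, ‖u ω + v ω‖ ^ 4 ∂P ≤
      (1 + η) * ∫ ω, ‖u ω‖ ^ 4 ∂P + (3 + 16 / η) * ∫ ω, ‖v ω‖ ^ 4 ∂P := by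
  have hcross := integrable_inner_norm_sq_smul hu hv
  have hzero : ∫ ω, inner ℝ (‖u ω‖ ^ 2 • u ω) (v ω) ∂P = 0 :=
    integral_inner_eq_zero_of_condExp_eq_zero hm ((hum.norm.pow 2).smul hum) hcross
      (hv.integrable (by norm_num)) hcond
  have hu4 := (integrable_norm_pow_four hu).const_mul (1 + η)
  have hv4 := (integrable_norm_pow_four hv).const_mul (3 + 16 / η)
  calc ∫ ω, ‖u ω + v ω‖ ^ 4 ∂P
      ≤ ∫ ω, ((1 + η) * ‖u ω‖ ^ 4 + 4 * inner ℝ (‖u ω‖ ^ 2 • u ω) (v ω)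
        + (3 + 16 / η) * ‖v ω‖ ^ 4) ∂P :=
        integral_mono (integrable_norm_pow_four (hu.add hv))
          ((hu4.add (hcross.const_mul 4)).add hv4) fun ω => norm_add_pow_four_le _ _ hη
    _ = _ := by
        refine (integral_add (hu4.add (hcross.const_mul 4)) hv4).trans ?_
        refine (congrArg (· + _) (integral_add hu4 (hcross.const_mul 4))).trans ?_
        simp only [integral_const_mul, hzero, mul_zero, add_zero]

theorem integral_norm_add_pow_four_le_of_contract {E' : Type*} [NormedAddCommGroup E']
    [IsFiniteMeasure P] [CompleteSpace E] (hm : m ≤ mΩ) {u v : Ω → E} {x : Ω → E'}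
    (hum : StronglyMeasurable[m] u) (hu : MemLp u 4 P) (hv : MemLp v 4 P) (hx : MemLp x 4 P)
    (hcond : P[v | m] =ᵐ[P] 0) {q : ℝ} (hq : 0 < q) (hq1 : q ≤ 1)
    (hux : ∀ ω, ‖u ω‖ ^ 2 ≤ (1 - q) * ‖x ω‖ ^ 2) :
    ∫ ω, ‖u ω + v ω‖ ^ 4 ∂P ≤
      (1 - q) * ∫ ω, ‖x ω‖ ^ 4 ∂P + 19 / q * ∫ ω, ‖v ω‖ ^ 4 ∂P := by
  refine (integral_norm_add_pow_four_le hm hum hu hv hcond hq).trans (add_le_add ?_ ?_)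
  · rw [← integral_const_mul, ← integral_const_mul]
    refine integral_mono ((integrable_norm_pow_four hu).const_mul _)
      ((integrable_norm_pow_four hx).const_mul _) fun ω => ?_
    calc (1 + q) * ‖u ω‖ ^ 4 = (1 + q) * (‖u ω‖ ^ 2) ^ 2 := by ring
      _ ≤ (1 + q) * ((1 - q) * ‖x ω‖ ^ 2) ^ 2 := by gcongr; exact hux ω
      _ = (1 - q ^ 2) * ((1 - q) * ‖x ω‖ ^ 4) := by ring
      _ ≤ (1 - q) * ‖x ω‖ ^ 4 :=
          mul_le_of_le_one_left (mul_nonneg (by linarith) (by positivity)) (by nlinarith)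
  · refine mul_le_mul_of_nonneg_right ?_ (integral_nonneg fun ω => by positivity)
    rw [le_div_iff₀ hq]
    field_simp
    linarith

end Moments

section LinearRecursion

theorem le_of_linear_recursion {f : ℕ → ℝ} {q r : ℝ} (hq : 0 < q) (hq1 : q ≤ 1)
    (h : ∀ n, f (n + 1) ≤ (1 - q) * f n + r) (n : ℕ) :
    f n ≤ (1 - q) ^ n * (f 0 - r / q) + r / q := by
  induction n with
  | zero => simp
  | succ n ih =>
    calc f (n + 1) ≤ (1 - q) * f n + r := h n
      _ ≤ (1 - q) * ((1 - q) ^ n * (f 0 - r / q) + r / q) + r := by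
          have : 0 ≤ 1 - q := by linarith
          gcongr
      _ = (1 - q) ^ (n + 1) * (f 0 - r / q) + r / q := by
          field_simp
          ring

theorem exists_tendsto_and_le_of_linear_recursion {f : ℕ → ℝ} {q r : ℝ} (hq : 0 < q)
    (hq1 : q ≤ 1) (h : ∀ n, f (n + 1) ≤ (1 - q) * f n + r) :
    ∃ u : ℕ → ℝ, Tendsto u atTop (𝓝 (r / q)) ∧ ∀ n, f n ≤ u n := by
  refine ⟨_, ?_, le_of_linear_recursion hq hq1 h⟩
  simpa using ((tendsto_pow_atTop_nhds_zero_of_lt_one (by linarith : 0 ≤ 1 - q)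
    (by linarith)).mul_const (f 0 - r / q)).add_const (r / q)

-- `d + (2β/q) e` satisfies a single linear recursion with rate `q / 2`.
theorem exists_tendsto_and_le_of_coupled_recursion {d e : ℕ → ℝ} {q β r : ℝ} (hq : 0 < q)
    (hq1 : q ≤ 1) (hβ : 0 ≤ β) (hd0 : ∀ n, 0 ≤ d n) (he0 : ∀ n, 0 ≤ e n)
    (he : ∀ n, e (n + 1) ≤ (1 - q) * e n + r) (hd : ∀ n, d (n + 1) ≤ (1 - q) * d n + β * e n) :
    ∃ u : ℕ → ℝ, Tendsto u atTop (𝓝 (4 * β * r / q ^ 2)) ∧ ∀ n, d n ≤ u n := by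
  have hrec : ∀ n, d (n + 1) + 2 * β / q * e (n + 1) ≤
      (1 - q / 2) * (d n + 2 * β / q * e n) + 2 * β / q * r := fun n => by
    have hweight : 2 * β / q * q * e n = 2 * β * e n := by field_simp
    have hscaled := mul_le_mul_of_nonneg_left (he n) (by positivity : 0 ≤ 2 * β / q)
    linarith [hd n, mul_nonneg hq.le (hd0 n)]
  obtain ⟨u, hu, hle⟩ := exists_tendsto_and_le_of_linear_recursion
    (f := fun n => d n + 2 * β / q * e n) (half_pos hq) (by linarith) hrec
  refine ⟨u, ?_, fun n => ?_⟩
  · convert hu using 2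
    field_simp
    ring
  · linarith [hle n, mul_nonneg (by positivity : 0 ≤ 2 * β / q) (he0 n)]

end LinearRecursion

section ErrorRecursion

variable {Ω : Type*} {A : Matrix (Fin N) (Fin N) ℝ} {wo : NetSpace N M}

theorem netGradient_add_netNoise (J : Fin N → AgentSpace M → ℝ)
    (ghat : Fin N → AgentSpace M → Ω → AgentSpace M) (w : NetSpace N M) (ω : Ω) :
    netGradient J w + netNoise J ghat w ω = WithLp.toLp 2 fun k => ghat k (w k) ω := by
  ext1 k
  exact add_sub_cancel _ _

theorem iterate_succ (A : Matrix (Fin N) (Fin N) ℝ) (μ : Fin N → ℝ)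
    (J : Fin N → AgentSpace M → ℝ) (ghat : ℕ → Fin N → AgentSpace M → Ω → AgentSpace M)
    (W₀ : Ω → NetSpace N M) (n : ℕ) (ω : Ω) :
    iterate A μ ghat W₀ (n + 1) ω = combineOp A (iterate A μ ghat W₀ n ω -
      stepOp μ (netGradient J (iterate A μ ghat W₀ n ω) +
        netNoise J (ghat (n + 1)) (iterate A μ ghat W₀ n ω) ω)) := by
  rw [netGradient_add_netNoise]
  ext1 k
  rw [combineOp_apply]
  rfl

theorem netError_succ (hwo : combineOp A wo = wo) (μ : Fin N → ℝ) (J : Fin N → AgentSpace M → ℝ)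
    (ghat : ℕ → Fin N → AgentSpace M → Ω → AgentSpace M) (W₀ : Ω → NetSpace N M)
    (n : ℕ) (ω : Ω) :
    netError A μ wo ghat W₀ (n + 1) ω =
      combineOp A (errorStep μ J wo (netError A μ wo ghat W₀ n ω)) +
        combineOp A (stepOp μ (netNoise J (ghat (n + 1)) (iterate A μ ghat W₀ n ω) ω)) := by
  rw [netError, iterate_succ A μ J, errorStep, netError, sub_sub_cancel]
  nth_rewrite 1 [← hwo]
  simp only [map_add, map_sub]
  abel

theorem netError_sub_longError_succ (hwo : combineOp A wo = wo) (μ : Fin N → ℝ)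
    (J : Fin N → AgentSpace M → ℝ) (ghat : ℕ → Fin N → AgentSpace M → Ω → AgentSpace M)
    (W₀ L₀ : Ω → NetSpace N M) (n : ℕ) (ω : Ω) :
    netError A μ wo ghat W₀ (n + 1) ω - longError A μ J wo ghat W₀ L₀ (n + 1) ω =
      longOp A μ J wo (netError A μ wo ghat W₀ n ω - longError A μ J wo ghat W₀ L₀ n ω) +
        combineOp A (stepOp μ (netGradient J (wo - netError A μ wo ghat W₀ n ω) +
          netHessian J wo (netError A μ wo ghat W₀ n ω))) := by
  rw [netError_succ hwo μ J, longError, map_sub]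
  simp only [longOp, errorStep, ContinuousLinearMap.comp_apply, _root_.sub_apply,
    ContinuousLinearMap.id_apply, map_add, map_sub]
  abel

end ErrorRecursion

section MomentRecursions

variable {Ω : Type*} {mΩ : MeasurableSpace Ω} {P : Measure Ω} {F : Filtration ℕ mΩ}
  {J : Fin N → AgentSpace M → ℝ} {wo : NetSpace N M}
  {ghat : ℕ → Fin N → AgentSpace M → Ω → AgentSpace M} {α σ q g K κ : ℝ}
  {A : Matrix (Fin N) (Fin N) ℝ} {μ : Fin N → ℝ} {R : NetSpace N M →L[ℝ] NetSpace N M}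
  {W₀ L₀ : Ω → NetSpace N M}

theorem continuous_errorStep (hg : ∀ k, Continuous (gradient (J k))) :
    Continuous (errorStep μ J wo) :=
  continuous_id.add ((stepOp μ).continuous.comp
    ((continuous_netGradient hg).comp (continuous_const.sub continuous_id)))

theorem IsGradientNoise.stronglyMeasurable_iterate (hnoise : IsGradientNoise P F J wo ghat α σ)
    (hg : ∀ k, Continuous (gradient (J k))) (hW : StronglyMeasurable[F 0] W₀) (n : ℕ) :
    StronglyMeasurable[F n] (iterate A μ ghat W₀ n) := by
  induction n with
  | zero => exact hW
  | succ n ih =>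
    have ih' := ih.mono (F.mono n.le_succ)
    rw [funext (iterate_succ A μ J ghat W₀ n)]
    exact (combineOp A).continuous.comp_stronglyMeasurable (ih'.sub
      ((stepOp μ).continuous.comp_stronglyMeasurable
        (((continuous_netGradient hg).comp_stronglyMeasurable ih').add (hnoise.adapted n _ ih))))

theorem IsGradientNoise.integral_pow_four_netNoise_le [IsProbabilityMeasure P]
    (hnoise : IsGradientNoise P F J wo ghat α σ) {n : ℕ} {W : Ω → NetSpace N M}
    (hW : StronglyMeasurable[F n] W) (hW4 : MemLp W 4 P) :
    ∫ ω, ‖netNoise J (ghat (n + 1)) (W ω) ω‖ ^ 4 ∂P ≤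
      α ^ 2 * ∫ ω, ‖wo - W ω‖ ^ 4 ∂P + σ ^ 4 := by
  have herr : Integrable (fun ω => α ^ 2 * ‖wo - W ω‖ ^ 4) P :=
    (integrable_norm_pow_four ((memLp_const wo).sub hW4)).const_mul _
  rw [← integral_condExp (F.le n)]
  refine (integral_mono_ae integrable_condExp (herr.add (integrable_const (σ ^ 4)))
    (hnoise.fourth_moment n W hW hW4)).trans_eq ?_
  refine (integral_add herr (integrable_const _)).trans ?_
  rw [integral_const_mul, integral_const, probReal_univ, one_smul]

namespace StepEstimates

theorem norm_combineOp_errorStep_le (h : StepEstimates R A μ J wo q g K) (x : NetSpace N M) :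
    ‖combineOp A (errorStep μ J wo x)‖ ≤ K * ‖R x‖ := by
  refine (h.lower _).trans (mul_le_mul_of_nonneg_left ?_ h.K_nonneg)
  refine le_of_sq_le_sq ((h.contract x).trans ?_) (norm_nonneg _)
  exact mul_le_of_le_one_left (sq_nonneg _) (sub_le_self 1 h.q_pos.le)

theorem memLp_combineOp_errorStep (h : StepEstimates R A μ J wo q g K)
    (hg : ∀ k, Continuous (gradient (J k))) {x : Ω → NetSpace N M} {p : ℝ≥0∞}
    (hx : MemLp x p P) : MemLp (fun ω => combineOp A (errorStep μ J wo (x ω))) p P :=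
  (R.comp_memLp' hx).of_le_mul
    (((combineOp A).continuous.comp (continuous_errorStep hg)).comp_aestronglyMeasurable hx.1)
    (ae_of_all _ fun ω => h.norm_combineOp_errorStep_le (x ω))

theorem norm_longOp_add_taylor_sq_le (h : StepEstimates R A μ J wo q g K) (hκ : 0 ≤ κ)
    (htaylor : ∀ x, ‖netGradient J (wo - x) + netHessian J wo x‖ ≤ κ * ‖x‖ ^ 2)
    (d x : NetSpace N M) :
    ‖R (longOp A μ J wo d +
        combineOp A (stepOp μ (netGradient J (wo - x) + netHessian J wo x)))‖ ^ 2 ≤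
      (1 - q / 2) * ‖R d‖ ^ 2 + 3 / q * (g * κ * K ^ 2) ^ 2 * ‖R x‖ ^ 4 := by
  have hq := h.q_pos
  have hg := h.g_nonneg
  have hremainder :
      ‖R (combineOp A (stepOp μ (netGradient J (wo - x) + netHessian J wo x)))‖ ≤
        g * κ * K ^ 2 * ‖R x‖ ^ 2 :=
    calc _ ≤ g * ‖netGradient J (wo - x) + netHessian J wo x‖ := h.noise _
      _ ≤ g * (κ * (K * ‖R x‖) ^ 2) := by
          gcongr
          refine (htaylor x).trans ?_
          gcongr
          exact h.lower x
      _ = g * κ * K ^ 2 * ‖R x‖ ^ 2 := by ring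
  rw [map_add]
  refine (norm_add_sq_le_of_contract hq h.q_le_one (h.contract_long d)).trans ?_
  calc _ ≤ (1 - q / 2) * ‖R d‖ ^ 2 + 3 / q * (g * κ * K ^ 2 * ‖R x‖ ^ 2) ^ 2 := by gcongr
    _ = _ := by ring

theorem integral_sq_longOp_add_taylor_le (h : StepEstimates R A μ J wo q g K) (hκ : 0 ≤ κ)
    (htaylor : ∀ x, ‖netGradient J (wo - x) + netHessian J wo x‖ ≤ κ * ‖x‖ ^ 2)
    {d x : Ω → NetSpace N M} (hd : MemLp d 2 P) (hx : MemLp x 4 P) :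
    ∫ ω, ‖R (longOp A μ J wo (d ω) + combineOp A (stepOp μ
        (netGradient J (wo - x ω) + netHessian J wo (x ω))))‖ ^ 2 ∂P ≤
      (1 - q / 2) * ∫ ω, ‖R (d ω)‖ ^ 2 ∂P +
        3 / q * (g * κ * K ^ 2) ^ 2 * ∫ ω, ‖R (x ω)‖ ^ 4 ∂P := by
  have hRd := (integrable_norm_sq (R.comp_memLp' hd)).const_mul (1 - q / 2)
  have hRx := (integrable_norm_pow_four (R.comp_memLp' hx)).const_mul
    (3 / q * (g * κ * K ^ 2) ^ 2)
  rw [← integral_const_mul, ← integral_const_mul]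
  refine le_of_le_of_eq ?_ (integral_add hRd hRx)
  exact integral_mono_of_nonneg (ae_of_all _ fun ω => sq_nonneg _) (hRd.add hRx)
    (ae_of_all _ fun ω => h.norm_longOp_add_taylor_sq_le hκ htaylor (d ω) (x ω))

variable [IsProbabilityMeasure P]

theorem memLp_iterate (h : StepEstimates R A μ J wo q g K)
    (hnoise : IsGradientNoise P F J wo ghat α σ) (hg : ∀ k, Continuous (gradient (J k)))
    (hwo : combineOp A wo = wo) (hW : StronglyMeasurable[F 0] W₀) (hW4 : MemLp W₀ 4 P) (n : ℕ) :
    MemLp (iterate A μ ghat W₀ n) 4 P := by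
  induction n with
  | zero => exact hW4
  | succ n ih =>
    have hsucc : iterate A μ ghat W₀ (n + 1) = fun ω =>
        wo - (combineOp A (errorStep μ J wo (wo - iterate A μ ghat W₀ n ω)) +
          combineOp A (stepOp μ (netNoise J (ghat (n + 1)) (iterate A μ ghat W₀ n ω) ω))) :=
      funext fun ω => by rw [← netError, ← netError_succ hwo μ J, netError, sub_sub_self]
    rw [hsucc]
    exact (memLp_const wo).sub ((h.memLp_combineOp_errorStep hg ((memLp_const wo).sub ih)).add
      ((combineOp A ∘L stepOp μ).comp_memLp'
        (hnoise.memLp n _ (hnoise.stronglyMeasurable_iterate hg hW n) ih)))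

theorem memLp_longError (h : StepEstimates R A μ J wo q g K)
    (hnoise : IsGradientNoise P F J wo ghat α σ) (hg : ∀ k, Continuous (gradient (J k)))
    (hwo : combineOp A wo = wo) (hW : StronglyMeasurable[F 0] W₀) (hW4 : MemLp W₀ 4 P)
    (hL : MemLp L₀ 2 P) (n : ℕ) : MemLp (longError A μ J wo ghat W₀ L₀ n) 2 P := by
  induction n with
  | zero => exact hL
  | succ n ih =>
    have hS := hnoise.memLp n _ (hnoise.stronglyMeasurable_iterate hg hW n)
      (h.memLp_iterate hnoise hg hwo hW hW4 n)
    exact ((longOp A μ J wo).comp_memLp' ih).add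
      ((combineOp A ∘L stepOp μ).comp_memLp' (hS.mono_exponent (by norm_num)))

theorem integral_pow_four_noise_le (h : StepEstimates R A μ J wo q g K)
    (hnoise : IsGradientNoise P F J wo ghat α σ) {n : ℕ} {W : Ω → NetSpace N M}
    (hW : StronglyMeasurable[F n] W) (hW4 : MemLp W 4 P) :
    ∫ ω, ‖R (combineOp A (stepOp μ (netNoise J (ghat (n + 1)) (W ω) ω)))‖ ^ 4 ∂P ≤
      g ^ 4 * (α ^ 2 * (K ^ 4 * ∫ ω, ‖R (wo - W ω)‖ ^ 4 ∂P) + σ ^ 4) := by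
  have herr : MemLp (fun ω => R (wo - W ω)) 4 P := R.comp_memLp' ((memLp_const wo).sub hW4)
  calc ∫ ω, ‖R (combineOp A (stepOp μ (netNoise J (ghat (n + 1)) (W ω) ω)))‖ ^ 4 ∂P
      ≤ g ^ 4 * ∫ ω, ‖netNoise J (ghat (n + 1)) (W ω) ω‖ ^ 4 ∂P :=
        integral_norm_pow_le_of_norm_le four_ne_zero (hnoise.memLp n W hW hW4) fun ω => h.noise _
    _ ≤ g ^ 4 * (α ^ 2 * ∫ ω, ‖wo - W ω‖ ^ 4 ∂P + σ ^ 4) := by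
        gcongr
        exact hnoise.integral_pow_four_netNoise_le hW hW4
    _ ≤ g ^ 4 * (α ^ 2 * (K ^ 4 * ∫ ω, ‖R (wo - W ω)‖ ^ 4 ∂P) + σ ^ 4) := by
        gcongr
        exact integral_norm_pow_le_of_norm_le four_ne_zero herr fun ω => h.lower _

theorem integral_pow_four_step_le (h : StepEstimates R A μ J wo q g K)
    (hnoise : IsGradientNoise P F J wo ghat α σ) (hg : ∀ k, Continuous (gradient (J k)))
    (hgain : 38 * g ^ 4 * α ^ 2 * K ^ 4 ≤ q ^ 2) {n : ℕ} {W : Ω → NetSpace N M}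
    (hW : StronglyMeasurable[F n] W) (hW4 : MemLp W 4 P) :
    ∫ ω, ‖R (combineOp A (errorStep μ J wo (wo - W ω))) +
        R (combineOp A (stepOp μ (netNoise J (ghat (n + 1)) (W ω) ω)))‖ ^ 4 ∂P ≤
      (1 - q / 2) * ∫ ω, ‖R (wo - W ω)‖ ^ 4 ∂P + 19 / q * (g ^ 4 * σ ^ 4) := by
  have hq := h.q_pos
  have herr : MemLp (fun ω => wo - W ω) 4 P := (memLp_const wo).sub hW4
  have hS := hnoise.memLp n W hW hW4
  set T : NetSpace N M →L[ℝ] NetSpace N M := R ∘L combineOp A ∘L stepOp μ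
  have hmean : P[fun ω => T (netNoise J (ghat (n + 1)) (W ω) ω) | F n] =ᵐ[P] 0 :=
    condExp_comp_eq_zero T (hS.integrable (by norm_num)) (hnoise.condExp_eq_zero n W hW hW4)
  have hcontract := integral_norm_add_pow_four_le_of_contract (F.le n)
    ((R.continuous.comp ((combineOp A).continuous.comp (continuous_errorStep hg))
      ).comp_stronglyMeasurable (stronglyMeasurable_const.sub hW))
    (R.comp_memLp' (h.memLp_combineOp_errorStep hg herr)) (T.comp_memLp' hS) (R.comp_memLp' herr)
    hmean hq h.q_le_one fun ω => h.contract (wo - W ω)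
  refine hcontract.trans ?_
  have hgain_le : 19 / q * (g ^ 4 * (α ^ 2 * K ^ 4)) ≤ q / 2 := by
    rw [div_mul_eq_mul_div, div_le_iff₀ hq]
    linarith
  calc _ ≤ (1 - q) * ∫ ω, ‖R (wo - W ω)‖ ^ 4 ∂P +
        19 / q * (g ^ 4 * (α ^ 2 * (K ^ 4 * ∫ ω, ‖R (wo - W ω)‖ ^ 4 ∂P) + σ ^ 4)) := by
        exact add_le_add le_rfl (mul_le_mul_of_nonneg_left
          (h.integral_pow_four_noise_le hnoise hW hW4) (by positivity))
    _ = (1 - q + 19 / q * (g ^ 4 * (α ^ 2 * K ^ 4))) * ∫ ω, ‖R (wo - W ω)‖ ^ 4 ∂P +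
        19 / q * (g ^ 4 * σ ^ 4) := by ring
    _ ≤ (1 - q / 2) * ∫ ω, ‖R (wo - W ω)‖ ^ 4 ∂P + 19 / q * (g ^ 4 * σ ^ 4) := by
        gcongr
        linarith

theorem limsup_lintegral_netError_sub_longError_le (h : StepEstimates R A μ J wo q g K)
    (hκ : 0 ≤ κ) (htaylor : ∀ x, ‖netGradient J (wo - x) + netHessian J wo x‖ ≤ κ * ‖x‖ ^ 2)
    (hg : ∀ k, Continuous (gradient (J k))) (hwo : combineOp A wo = wo)
    (hgain : 38 * g ^ 4 * α ^ 2 * K ^ 4 ≤ q ^ 2) (hnoise : IsGradientNoise P F J wo ghat α σ)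
    (hW : StronglyMeasurable[F 0] W₀) (hW4 : MemLp W₀ 4 P) (hL : MemLp L₀ 2 P) :
    limsup (fun n => ∫⁻ ω, ‖netError A μ wo ghat W₀ n ω -
        longError A μ J wo ghat W₀ L₀ n ω‖ₑ ^ 2 ∂P) atTop ≤
      ENNReal.ofReal (912 * κ ^ 2 * σ ^ 4 * K ^ 6 * g ^ 6 / q ^ 4) := by
  have hq := h.q_pos
  set x := netError A μ wo ghat W₀
  set d := fun n ω => x n ω - longError A μ J wo ghat W₀ L₀ n ω
  have hx : ∀ n, MemLp (x n) 4 P := fun n =>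
    (memLp_const wo).sub (h.memLp_iterate hnoise hg hwo hW hW4 n)
  have hd : ∀ n, MemLp (d n) 2 P := fun n => ((hx n).mono_exponent (by norm_num)).sub
    (h.memLp_longError hnoise hg hwo hW hW4 hL n)
  have fourth_moment_succ : ∀ n, ∫ ω, ‖R (x (n + 1) ω)‖ ^ 4 ∂P ≤
      (1 - q / 2) * ∫ ω, ‖R (x n ω)‖ ^ 4 ∂P + 19 / q * (g ^ 4 * σ ^ 4) := fun n => by
    simp only [x, netError_succ hwo μ J, map_add]
    exact h.integral_pow_four_step_le hnoise hg hgain (hnoise.stronglyMeasurable_iterate hg hW n)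
      (h.memLp_iterate hnoise hg hwo hW hW4 n)
  have mean_square_succ : ∀ n, ∫ ω, ‖R (d (n + 1) ω)‖ ^ 2 ∂P ≤ (1 - q / 2) *
      ∫ ω, ‖R (d n ω)‖ ^ 2 ∂P + 3 / q * (g * κ * K ^ 2) ^ 2 * ∫ ω, ‖R (x n ω)‖ ^ 4 ∂P :=
    fun n => by
    simp only [d, x, netError_sub_longError_succ hwo μ J]
    exact h.integral_sq_longOp_add_taylor_le hκ htaylor (hd n) (hx n)
  obtain ⟨u, hu, hle⟩ := exists_tendsto_and_le_of_coupled_recursion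
    (d := fun n => ∫ ω, ‖R (d n ω)‖ ^ 2 ∂P) (e := fun n => ∫ ω, ‖R (x n ω)‖ ^ 4 ∂P)
    (half_pos hq) (by linarith [h.q_le_one]) (by positivity)
    (fun n => integral_nonneg fun ω => by positivity)
    (fun n => integral_nonneg fun ω => by positivity) fourth_moment_succ mean_square_succ
  refine limsup_lintegral_enorm_sq_le hd (u := fun n => K ^ 2 * u n) ?_ fun n => ?_
  · convert hu.const_mul (K ^ 2) using 2
    field_simp
    ring
  · refine (integral_norm_pow_le_of_norm_le two_ne_zero (R.comp_memLp' (hd n))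
      fun ω => h.lower _).trans ?_
    gcongr
    exact hle n

end StepEstimates

theorem noise_gain_le_sq {a c K s : ℝ} (hs : 0 ≤ s) (hsc : s ≤ c / (7 * (K ^ 4 * |a| + 1))) :
    38 * (K * s) ^ 4 * a ^ 2 * K ^ 4 ≤ (c * s) ^ 2 := by
  have hc : 7 * (K ^ 4 * |a|) * s ≤ c := by
    linarith [(le_div_iff₀ (by positivity)).1 hsc]
  calc 38 * (K * s) ^ 4 * a ^ 2 * K ^ 4 ≤ 49 * (K * s) ^ 4 * a ^ 2 * K ^ 4 := by gcongr; norm_num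
    _ = (7 * (K ^ 4 * |a|) * s) ^ 2 * s ^ 2 := by
        rw [← sq_abs a]
        ring
    _ ≤ (c * s) ^ 2 := by
        rw [mul_pow c]
        gcongr

end MomentRecursions

end MultitaskDiffusion

open MultitaskDiffusion in
theorem mainTheorem6_general {N M G : ℕ}
    (graph : SimpleGraph (Fin N)) (group : Fin N → Fin G)
    (J : Fin N → AgentSpace M → ℝ)
    (wo : NetSpace N M)
    (A : Matrix (Fin N) (Fin N) ℝ)
    (lamL lamU : Fin N → ℝ) (κH α σ τ : ℝ)
    (hgroup : IsGrouping graph group wo)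
    (hA : IsCombination graph group A)
    (hJ : IsConvexCostFamily group J wo lamL lamU κH) (hτ : 0 < τ) :
    ∃ μ₀ : ℝ, 0 < μ₀ ∧ ∃ C : ℝ, 0 ≤ C ∧
      ∀ μ : Fin N → ℝ, (∀ k, 0 < μ k) →
        (∀ k, τ * stepMax μ ≤ μ k) →
        stepMax μ ≤ μ₀ →
        ∀ (Ω : Type*) [mΩ : MeasurableSpace Ω] (P : Measure Ω) [IsProbabilityMeasure P]
          (F : Filtration ℕ mΩ)
          (ghat : ℕ → Fin N → AgentSpace M → Ω → AgentSpace M),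
          IsGradientNoise P F J wo ghat α σ →
          ∀ W₀ L₀ : Ω → NetSpace N M,
            StronglyMeasurable[F 0] W₀ → MemLp W₀ 4 P → MemLp L₀ 2 P →
            limsup (fun n : ℕ => ∫⁻ ω,
                ‖netError A μ wo ghat W₀ n ω
                  - longError A μ J wo ghat W₀ L₀ n ω‖ₑ ^ 2 ∂P) atTop
              ≤ ENNReal.ofReal (C * stepMax μ ^ 2) := by
  obtain ⟨R, c, K, t₀, hc, ht₀, hstep⟩ := hJ.exists_stepEstimates hgroup hA hτ
  refine ⟨min t₀ (c / (7 * (K ^ 4 * |α| + 1))), by positivity,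
    912 * κH ^ 2 * σ ^ 4 * K ^ 12 / c ^ 4, by positivity,
    fun μ hμ hτμ hμ₀ Ω mΩ P _ F ghat hnoise W₀ L₀ hW hW4 hL => ?_⟩
  rcases isEmpty_or_nonempty (Fin N) with hN | ⟨⟨k₀⟩⟩
  · have hzero : ∀ x : NetSpace N M, ‖x‖ₑ = 0 := fun x => by rw [Subsingleton.elim x 0, enorm_zero]
    simp [hzero]
  have hle : ∀ k, μ k ≤ stepMax μ := le_ciSup (Set.finite_range μ).bddAbove
  have hmax : 0 < stepMax μ := (hμ k₀).trans_le (hle k₀)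
  have hest := hstep μ (stepMax μ) hmax (hμ₀.trans (min_le_left _ _)) hτμ hle
  refine (hest.limsup_lintegral_netError_sub_longError_le hJ.κ_nonneg
    hJ.norm_netGradient_sub_add_netHessian_le (fun k => (hJ.differentiable_gradient k).continuous)
    (hA.combineOp_eq_self hgroup)
    (noise_gain_le_sq hmax.le (hμ₀.trans (min_le_right _ _))) hnoise hW hW4 hL).trans_eq ?_
  congr 1
  field_simp

theorem mainTheorem6 {N M G : ℕ}
    (graph : SimpleGraph (Fin N)) (group : Fin N → Fin G)
    (J : Fin N → MultitaskDiffusion.AgentSpace M → ℝ)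
    (wo : MultitaskDiffusion.NetSpace N M)
    (A : Matrix (Fin N) (Fin N) ℝ)
    (lamL lamU : Fin N → ℝ) (κH α σ τ : ℝ)
    (hgroup : MultitaskDiffusion.IsGrouping graph group wo)
    (hA : MultitaskDiffusion.IsCombination graph group A)
    (hJ : MultitaskDiffusion.IsCostFamily group J wo lamL lamU κH)
    (hα : 0 ≤ α) (hσ : 0 ≤ σ) (hτ : 0 < τ) :
    ∃ μ₀ : ℝ, 0 < μ₀ ∧ ∃ C : ℝ, 0 ≤ C ∧
      ∀ μ : Fin N → ℝ, (∀ k, 0 < μ k) →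
        (∀ k, τ * MultitaskDiffusion.stepMax μ ≤ μ k) →
        MultitaskDiffusion.stepMax μ ≤ μ₀ →
        ∀ (Ω : Type*) [mΩ : MeasurableSpace Ω] (P : Measure Ω) [IsProbabilityMeasure P]
          (F : Filtration ℕ mΩ)
          (ghat : ℕ → Fin N → MultitaskDiffusion.AgentSpace M → Ω →
            MultitaskDiffusion.AgentSpace M),
          MultitaskDiffusion.IsGradientNoise P F J wo ghat α σ →
          ∀ W₀ L₀ : Ω → MultitaskDiffusion.NetSpace N M,
            StronglyMeasurable[F 0] W₀ → MemLp W₀ 4 P → MemLp L₀ 2 P →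
            limsup (fun n : ℕ => ∫⁻ ω,
                ‖MultitaskDiffusion.netError A μ wo ghat W₀ n ω
                  - MultitaskDiffusion.longError A μ J wo ghat W₀ L₀ n ω‖ₑ ^ 2 ∂P) atTop
              ≤ ENNReal.ofReal (C * MultitaskDiffusion.stepMax μ ^ 2) :=
  mainTheorem6_general graph group J wo A lamL lamU κH α σ τ hgroup hA hJ.isConvexCostFamily hτ
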